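/- Let $\mathfrak A$ be a real (or complex) Banach algebra, $J\ge 0$, and $X_1,\dots,X_J\in\mathfrak A$. For $t\in\mathbb R$ put $$S_2(t)=e^{tX_J/2}\cdots e^{tX_1/2}\,e^{tX_1/2}\cdots e^{tX_J/2}$$ (for two operators $X=X_2$, $Y=X_1$ this is $e^{tX/2}e^{tY}e^{tX/2}$), and let $\alpha_\ell\in\mathfrak A$ be the coefficient of $t^\ell$ in the formal logarithm $\log S_2(t)=\sum_{k\ge1}\frac{(-1)^{k+1}}{k}(S_2(t)-1)^k\in\mathfrak A[[t]]$. Write $[x_1,\dots,x_L]=[x_1,[x_2,[\dots,x_L]]]$ for nested commutators, where $[x,y]=xy-yx$, with $x^n$ standing for $n$ consecutive entries $x$, and set $$\beta_5=[\alpha_1,\alpha_1,\alpha_3],\quad \beta_7=[\alpha_1,\alpha_1,\alpha_5],\quad \gamma_7=[\alpha_3,\alpha_3,\alpha_1],\quad \delta_7=[\alpha_1^4,\alpha_3],\quad \beta_9=[\alpha_1,\alpha_1,\alpha_7],$$ $$\gamma_9^{(1)}=[\alpha_1,\alpha_3,\alpha_5],\quad \gamma_9^{(2)}=[\alpha_3,\alpha_1,\alpha_5],\quad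 \gamma_9^{(3)}=[\alpha_5,\alpha_1,\alpha_3],$$ $$\delta_9^{(1)}=[\alpha_1^4,\alpha_5],\quad \delta_9^{(2)}=[\alpha_3,\alpha_1^3,\alpha_3],\quad \delta_9^{(3)}=[\alpha_1,\alpha_3,\alpha_1^2,\alpha_3],\quad \epsilon_9=[\alpha_1^6,\alpha_3].$$ For real $w_0,w_1,\dots$ and $m\ge0$ let $$S^{(m)}(\tau)=S_2(w_m\tau)\cdots S_2(w_1\tau)\,S_2(w_0\tau)\,S_2(w_1\tau)\cdots S_2(w_m\tau).$$ Define polynomials with rational coefficients in $w_0,w_1,\dots$ recursively by $A_{j,0}=w_0^j$ ($j=1,3,5,7,9$), all other coefficients being $0$ for $m=0$, and, writing $v=w_{m+1}$ and $A_j=A_{j,m}$, $B_j=B_{j,m}$, $C_7=C_{7,m}$, $D_7=D_{7,m}$, by $A_{j,m+1}=A_j+2v^j$ and $$B_{j,m+1}-B_{j}=\tfrac16(A_1^2v^{j-2}-A_1A_{j-2}v)-\tfrac16(A_{j-2}v^2-A_1v^{j-1})\qquad(j=5,7,9),$$ $$C_{7,m+1}-C_{7}=\tfrac16(A_3^2v-A_1A_3v^3)+\tfrac16(A_3v^4-A_1v^6),$$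 $$\begin{aligned}D_{7,m+1}-D_{7}={}&-\tfrac16(A_1B_5v+B_5v^2)+\tfrac7{360}(A_3v^4-A_1v^6)-\tfrac1{360}(A_1^4v^3-A_1^3A_3v)+\tfrac1{90}(A_1^3v^4-A_1^2A_3v^2)\\&+\tfrac1{45}(A_1A_3v^3-A_1^2v^5)-\tfrac1{60}(A_1^2v^5-A_1A_3v^3)+\tfrac1{30}(A_1^2A_3v^2-A_1^3v^4),\end{aligned}$$ $$C^{(1)}_{9,m+1}-C^{(1)}_{9,m}=\tfrac16(A_1A_3v^5-A_1A_5v^3)-\tfrac16(A_5v^4-A_3v^6),$$ $$C^{(2)}_{9,m+1}-C^{(2)}_{9,m}=\tfrac16(A_1A_3v^5-A_3A_5v)-\tfrac16(A_5v^4-A_1v^8),$$ $$C^{(3)}_{9,m+1}-C^{(3)}_{9,m}=\tfrac16(A_1A_5v^3-A_3A_5v)-\tfrac16(A_3v^6-A_1v^8),$$ $$\begin{aligned}D^{(1)}_{9,m+1}-D^{(1)}_{9,m}={}&-\tfrac16(A_1B_7v+B_7v^2)+\tfrac7{360}(A_5v^4-A_1v^8)-\tfrac1{360}(A_1^4v^5-A_1^3A_5v)+\tfrac1{90}(A_1^3v^6-A_1^2A_5v^2)\\&+\tfrac1{45}(A_1A_5v^3-A_1^2v^7)-\tfrac1{60}(A_1^2v^7-A_1A_5v^3)+\tfrac1{30}(A_1^2A_5v^2-A_1^3v^6),\end{aligned}$$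 $$\begin{aligned}D^{(2)}_{9,m+1}-D^{(2)}_{9,m}={}&-\tfrac16(A_3B_5v+B_5v^4)+\tfrac16(A_1B_5v^3-A_3B_5v)+\tfrac7{360}(A_3v^6-A_1v^8)-\tfrac1{360}(A_1^3A_3v^3-A_1^2A_3^2v)\\&+\tfrac1{90}(A_1^3v^6-A_1^2A_3v^4)+\tfrac1{45}(A_3^2v^3-A_1A_3v^5)-\tfrac1{60}(A_1^2v^7-A_1A_3v^5)+\tfrac1{30}(A_1A_3^2v^2-A_1^2A_3v^4),\end{aligned}$$ $$\begin{aligned}D^{(3)}_{9,m+1}-D^{(3)}_{9,m}={}&-\tfrac16(A_1B_5v^3+B_5v^4)-\tfrac16(A_1B_5v^3-A_3B_5v)+\tfrac16(A_1C_7v+C_7v^2)+\tfrac{14}{360}(A_3v^6-A_1v^8)\\&-\tfrac2{360}(A_1^3A_3v^3-A_1^2A_3^2v)+\tfrac2{90}(A_1^2A_3v^4-A_1A_3^2v^2)+\tfrac2{45}(A_1A_3v^5-A_1^2v^7)-\tfrac1{60}(A_1^2v^7-A_1A_3v^5)\\&-\tfrac1{60}(A_1A_3v^5-A_3^2v^3)+\tfrac1{30}(A_1A_3^2v^2-A_1^2A_3v^4)+\tfrac1{30}(A_1^2A_3v^4-A_1^3v^6),\end{aligned}$$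 $$\begin{aligned}E_{9,m+1}-E_{9,m}={}&-\tfrac16(A_1D_7v+D_7v^2)+\tfrac7{360}B_5v^4+\tfrac1{360}A_1^3B_5v-\tfrac1{90}A_1^2B_5v^2+\tfrac1{45}A_1B_5v^3+\tfrac1{60}A_1B_5v^3+\tfrac1{30}A_1^2B_5v^2\\&-\tfrac{31}{15120}(A_3v^6-A_1v^8)-\tfrac{31}{5040}(A_1A_3v^5-A_1^2v^7)-\tfrac{13}{1890}(A_1^2A_3v^4-A_1^3v^6)\\&-\tfrac{53}{15120}(A_1^3A_3v^3-A_1^4v^5)-\tfrac1{1260}(A_1^4A_3v^2-A_1^5v^4)-\tfrac1{15120}(A_1^5A_3v-A_1^6v^3).\end{aligned}$$ Then for every $m\ge0$: 1. All of these coefficients with index $m$ are polynomials in $w_0,\dots,w_m$ only, and $C^{(2)}_{9,m}=C^{(1)}_{9,m}+C^{(3)}_{9,m}$. 2. For all $J$, all $X_1,\dots,X_J\in\mathfrak A$ and all real $w_0,w_1,\dots$ there is $r:\mathbb R\to\mathfrak A$ with $r(\tau)=O(\tau^{11})$ as $\tau\to0$ such that, for all $\tau$ in a neighbourhood of $0$,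 $$\begin{aligned}S^{(m)}(\tau)=\exp\Big\{&\tau A_{1,m}\alpha_1+\tau^3A_{3,m}\alpha_3+\tau^5(A_{5,m}\alpha_5+B_{5,m}\beta_5)+\tau^7(A_{7,m}\alpha_7+B_{7,m}\beta_7+C_{7,m}\gamma_7+D_{7,m}\delta_7)\\&+\tau^9\big(A_{9,m}\alpha_9+B_{9,m}\beta_9+C^{(1)}_{9,m}\gamma^{(1)}_9+C^{(2)}_{9,m}\gamma^{(2)}_9+C^{(3)}_{9,m}\gamma^{(3)}_9\\&\qquad+D^{(1)}_{9,m}\delta^{(1)}_9+D^{(2)}_{9,m}\delta^{(2)}_9+D^{(3)}_{9,m}\delta^{(3)}_9+E_{9,m}\epsilon_9\big)+r(\tau)\Big\}.\end{aligned}$$ 3. If the real numbers $w_0,\dots,w_m$ satisfy $A_{1,m}=1$ and the fifteen equations $A_{3,m}=A_{5,m}=B_{5,m}=A_{7,m}=B_{7,m}=C_{7,m}=D_{7,m}=A_{9,m}=B_{9,m}=C^{(1)}_{9,m}=C^{(3)}_{9,m}=D^{(1)}_{9,m}=D^{(2)}_{9,m}=D^{(3)}_{9,m}=E_{9,m}=0$,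 then $S^{(m)}$ is a product formula of order ten: $S^{(m)}(\tau)=e^{\tau(X_1+\dots+X_J)}+O(\tau^{11})$ as $\tau\to0$. -/

import Mathlib

open Filter Topology Asymptotics

namespace Yoshida

section Operators

variable {𝔸 : Type*} [NormedRing 𝔸] [NormedAlgebra ℝ 𝔸]

/-- The symmetric second-order product formula for operators `X 0, …, X (J-1)`:
`exp(t X_{J-1}/2) ⋯ exp(t X_0/2) · exp(t X_0/2) ⋯ exp(t X_{J-1}/2)`. -/
noncomputable def S₂ {J : ℕ} (X : Fin J → 𝔸) (t : ℝ) : 𝔸 :=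
  (List.ofFn fun j => NormedSpace.exp ((t / 2) • X j)).reverse.prod *
    (List.ofFn fun j => NormedSpace.exp ((t / 2) • X j)).prod

/-- For two operators, `S₂` is `exp(tX/2) exp(tY) exp(tX/2)`. -/
theorem S₂_pair [CompleteSpace 𝔸] (X Y : 𝔸) (t : ℝ) :
    S₂ ![Y, X] t =
      NormedSpace.exp ((t / 2) • X) * NormedSpace.exp (t • Y) * NormedSpace.exp ((t / 2) • X) := by
  have h : NormedSpace.exp (t • Y) =
      NormedSpace.exp ((t / 2) • Y) * NormedSpace.exp ((t / 2) • Y) := by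
    let _ : NormedAlgebra ℚ 𝔸 := NormedAlgebra.restrictScalars ℚ ℝ 𝔸
    rw [← NormedSpace.exp_add_of_commute (Commute.refl _), ← add_smul, add_halves]
  simp [S₂, List.ofFn_succ, h, mul_assoc]

/-- Yoshida's ansatz
`S₂(w_m τ) ⋯ S₂(w_1 τ) · S₂(w_0 τ) · S₂(w_1 τ) ⋯ S₂(w_m τ)`. -/
noncomputable def ansatz {J : ℕ} (X : Fin J → 𝔸) (w : ℕ → ℝ) (m : ℕ) (τ : ℝ) : 𝔸 :=
  ((List.range m).map fun j => S₂ X (w (m - j) * τ)).prod * S₂ X (w 0 * τ) *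
    ((List.range m).map fun j => S₂ X (w (j + 1) * τ)).prod

/-- The formal exponential series `∑ xⁿ tⁿ / n!` in `𝔸⟦t⟧`. -/
noncomputable def formalExp (x : 𝔸) : PowerSeries 𝔸 :=
  PowerSeries.mk fun n => ((n.factorial : ℝ)⁻¹) • x ^ n

/-- The Taylor series of `S₂` as a formal power series in `t`. -/
noncomputable def formalS₂ {J : ℕ} (X : Fin J → 𝔸) : PowerSeries 𝔸 :=
  (List.ofFn fun j => formalExp ((1 / 2 : ℝ) • X j)).reverse.prod *
    (List.ofFn fun j => formalExp ((1 / 2 : ℝ) • X j)).prod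

/-- `α_ℓ`: the coefficient of `t^ℓ` in `log S₂(t) = ∑_{k ≥ 1} (-1)^(k+1) (S₂(t) - 1)^k / k`.
As `S₂(t) - 1` has no constant term, only `k ≤ ℓ` contributes. -/
noncomputable def α {J : ℕ} (X : Fin J → 𝔸) (l : ℕ) : 𝔸 :=
  ∑ k ∈ Finset.Icc 1 l,
    ((-1 : ℝ) ^ (k + 1) / (k : ℝ)) • PowerSeries.coeff l ((formalS₂ X - 1) ^ k)

/-- Right-nested commutator `[x₁, x₂, …, x_L] = [x₁, [x₂, […, x_L]]]`. -/
def nest : List 𝔸 → 𝔸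
  | [] => 0
  | [x] => x
  | x :: y :: l => ⁅x, nest (y :: l)⁆

end Operators

/-- Names of the coefficients in the expansion of the logarithm of the ansatz up to order nine. -/
inductive Idx
  | A1 | A3 | A5 | B5 | A7 | B7 | C7 | D7 | A9 | B9
  | C9₁ | C9₂ | C9₃ | D9₁ | D9₂ | D9₃ | E9

open Idx

set_option maxHeartbeats 2000000 in
/-- The passage from the coefficients of `S^(m)` to those of `S^(m+1)`, with `v = w_{m+1}`;
`k` embeds the rational numbers. -/
def step {R : Type*} [CommRing R] (k : ℚ →+* R) (v : R) (c : Idx → R) : Idx → R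
  | A1 => c A1 + 2 * v
  | A3 => c A3 + 2 * v ^ 3
  | A5 => c A5 + 2 * v ^ 5
  | B5 => c B5 + k (1 / 6) * (c A1 ^ 2 * v ^ 3 - c A1 * c A3 * v)
      - k (1 / 6) * (c A3 * v ^ 2 - c A1 * v ^ 4)
  | A7 => c A7 + 2 * v ^ 7
  | B7 => c B7 + k (1 / 6) * (c A1 ^ 2 * v ^ 5 - c A1 * c A5 * v)
      - k (1 / 6) * (c A5 * v ^ 2 - c A1 * v ^ 6)
  | C7 => c C7 + k (1 / 6) * (c A3 ^ 2 * v - c A1 * c A3 * v ^ 3)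
      + k (1 / 6) * (c A3 * v ^ 4 - c A1 * v ^ 6)
  | D7 => c D7 - k (1 / 6) * (c A1 * c B5 * v + c B5 * v ^ 2)
      + k (7 / 360) * (c A3 * v ^ 4 - c A1 * v ^ 6)
      - k (1 / 360) * (c A1 ^ 4 * v ^ 3 - c A1 ^ 3 * c A3 * v)
      + k (1 / 90) * (c A1 ^ 3 * v ^ 4 - c A1 ^ 2 * c A3 * v ^ 2)
      + k (1 / 45) * (c A1 * c A3 * v ^ 3 - c A1 ^ 2 * v ^ 5)
      - k (1 / 60) * (c A1 ^ 2 * v ^ 5 - c A1 * c A3 * v ^ 3)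
      + k (1 / 30) * (c A1 ^ 2 * c A3 * v ^ 2 - c A1 ^ 3 * v ^ 4)
  | A9 => c A9 + 2 * v ^ 9
  | B9 => c B9 + k (1 / 6) * (c A1 ^ 2 * v ^ 7 - c A1 * c A7 * v)
      - k (1 / 6) * (c A7 * v ^ 2 - c A1 * v ^ 8)
  | C9₁ => c C9₁ + k (1 / 6) * (c A1 * c A3 * v ^ 5 - c A1 * c A5 * v ^ 3)
      - k (1 / 6) * (c A5 * v ^ 4 - c A3 * v ^ 6)
  | C9₂ => c C9₂ + k (1 / 6) * (c A1 * c A3 * v ^ 5 - c A3 * c A5 * v)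
      - k (1 / 6) * (c A5 * v ^ 4 - c A1 * v ^ 8)
  | C9₃ => c C9₃ + k (1 / 6) * (c A1 * c A5 * v ^ 3 - c A3 * c A5 * v)
      - k (1 / 6) * (c A3 * v ^ 6 - c A1 * v ^ 8)
  | D9₁ => c D9₁ - k (1 / 6) * (c A1 * c B7 * v + c B7 * v ^ 2)
      + k (7 / 360) * (c A5 * v ^ 4 - c A1 * v ^ 8)
      - k (1 / 360) * (c A1 ^ 4 * v ^ 5 - c A1 ^ 3 * c A5 * v)
      + k (1 / 90) * (c A1 ^ 3 * v ^ 6 - c A1 ^ 2 * c A5 * v ^ 2)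
      + k (1 / 45) * (c A1 * c A5 * v ^ 3 - c A1 ^ 2 * v ^ 7)
      - k (1 / 60) * (c A1 ^ 2 * v ^ 7 - c A1 * c A5 * v ^ 3)
      + k (1 / 30) * (c A1 ^ 2 * c A5 * v ^ 2 - c A1 ^ 3 * v ^ 6)
  | D9₂ => c D9₂ - k (1 / 6) * (c A3 * c B5 * v + c B5 * v ^ 4)
      + k (1 / 6) * (c A1 * c B5 * v ^ 3 - c A3 * c B5 * v)
      + k (7 / 360) * (c A3 * v ^ 6 - c A1 * v ^ 8)
      - k (1 / 360) * (c A1 ^ 3 * c A3 * v ^ 3 - c A1 ^ 2 * c A3 ^ 2 * v)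
      + k (1 / 90) * (c A1 ^ 3 * v ^ 6 - c A1 ^ 2 * c A3 * v ^ 4)
      + k (1 / 45) * (c A3 ^ 2 * v ^ 3 - c A1 * c A3 * v ^ 5)
      - k (1 / 60) * (c A1 ^ 2 * v ^ 7 - c A1 * c A3 * v ^ 5)
      + k (1 / 30) * (c A1 * c A3 ^ 2 * v ^ 2 - c A1 ^ 2 * c A3 * v ^ 4)
  | D9₃ => c D9₃ - k (1 / 6) * (c A1 * c B5 * v ^ 3 + c B5 * v ^ 4)
      - k (1 / 6) * (c A1 * c B5 * v ^ 3 - c A3 * c B5 * v)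
      + k (1 / 6) * (c A1 * c C7 * v + c C7 * v ^ 2)
      + k (14 / 360) * (c A3 * v ^ 6 - c A1 * v ^ 8)
      - k (2 / 360) * (c A1 ^ 3 * c A3 * v ^ 3 - c A1 ^ 2 * c A3 ^ 2 * v)
      + k (2 / 90) * (c A1 ^ 2 * c A3 * v ^ 4 - c A1 * c A3 ^ 2 * v ^ 2)
      + k (2 / 45) * (c A1 * c A3 * v ^ 5 - c A1 ^ 2 * v ^ 7)
      - k (1 / 60) * (c A1 ^ 2 * v ^ 7 - c A1 * c A3 * v ^ 5)
      - k (1 / 60) * (c A1 * c A3 * v ^ 5 - c A3 ^ 2 * v ^ 3)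
      + k (1 / 30) * (c A1 * c A3 ^ 2 * v ^ 2 - c A1 ^ 2 * c A3 * v ^ 4)
      + k (1 / 30) * (c A1 ^ 2 * c A3 * v ^ 4 - c A1 ^ 3 * v ^ 6)
  | E9 => c E9 - k (1 / 6) * (c A1 * c D7 * v + c D7 * v ^ 2)
      + k (7 / 360) * (c B5 * v ^ 4)
      + k (1 / 360) * (c A1 ^ 3 * c B5 * v)
      - k (1 / 90) * (c A1 ^ 2 * c B5 * v ^ 2)
      + k (1 / 45) * (c A1 * c B5 * v ^ 3)
      + k (1 / 60) * (c A1 * c B5 * v ^ 3)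
      + k (1 / 30) * (c A1 ^ 2 * c B5 * v ^ 2)
      - k (31 / 15120) * (c A3 * v ^ 6 - c A1 * v ^ 8)
      - k (31 / 5040) * (c A1 * c A3 * v ^ 5 - c A1 ^ 2 * v ^ 7)
      - k (13 / 1890) * (c A1 ^ 2 * c A3 * v ^ 4 - c A1 ^ 3 * v ^ 6)
      - k (53 / 15120) * (c A1 ^ 3 * c A3 * v ^ 3 - c A1 ^ 4 * v ^ 5)
      - k (1 / 1260) * (c A1 ^ 4 * c A3 * v ^ 2 - c A1 ^ 5 * v ^ 4)
      - k (1 / 15120) * (c A1 ^ 5 * c A3 * v - c A1 ^ 6 * v ^ 3)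

/-- The coefficients of `S^(0)(τ) = S₂(w_0 τ)`, with `v = w_0`. -/
def init {R : Type*} [CommRing R] (v : R) : Idx → R
  | A1 => v
  | A3 => v ^ 3
  | A5 => v ^ 5
  | A7 => v ^ 7
  | A9 => v ^ 9
  | _ => 0

/-- The coefficients `A_{1,m}, …, E_{9,m}` as polynomials in the variables `w_0, w_1, …`. -/
noncomputable def coeffPoly : ℕ → Idx → MvPolynomial ℕ ℚ
  | 0 => init (MvPolynomial.X 0)
  | m + 1 => step MvPolynomial.C (MvPolynomial.X (m + 1)) (coeffPoly m)

/-- The values of the coefficient polynomials at a real sequence `w`. -/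
noncomputable def coeffVal (w : ℕ → ℝ) (m : ℕ) (i : Idx) : ℝ :=
  MvPolynomial.aeval w (coeffPoly m i)

/-- The odd expansion up to order nine in `τ`, with coefficients `c`, in the multicommutators of
`a 1, a 3, a 5, a 7, a 9`. -/
noncomputable def expansion {𝔸 : Type*} [NormedRing 𝔸] [NormedAlgebra ℝ 𝔸]
    (a : ℕ → 𝔸) (c : Idx → ℝ) (τ : ℝ) : 𝔸 :=
  τ • c A1 • a 1
  + τ ^ 3 • c A3 • a 3
  + τ ^ 5 • (c A5 • a 5
      + c B5 • nest [a 1, a 1, a 3])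
  + τ ^ 7 • (c A7 • a 7
      + c B7 • nest [a 1, a 1, a 5]
      + c C7 • nest [a 3, a 3, a 1]
      + c D7 • nest [a 1, a 1, a 1, a 1, a 3])
  + τ ^ 9 • (c A9 • a 9
      + c B9 • nest [a 1, a 1, a 7]
      + c C9₁ • nest [a 1, a 3, a 5]
      + c C9₂ • nest [a 3, a 1, a 5]
      + c C9₃ • nest [a 5, a 1, a 3]
      + c D9₁ • nest [a 1, a 1, a 1, a 1, a 5]
      + c D9₂ • nest [a 3, a 1, a 1, a 1, a 3]
      + c D9₃ • nest [a 1, a 3, a 1, a 1, a 3]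
      + c E9 • nest [a 1, a 1, a 1, a 1, a 1, a 1, a 3])

/-- The normalization `A₁ = 1` together with the fifteen tenth-order conditions. -/
def TenthOrderConditions (c : Idx → ℝ) : Prop :=
  c A1 = 1 ∧
  c A3 = 0 ∧
  c A5 = 0 ∧ c B5 = 0 ∧
  c A7 = 0 ∧ c B7 = 0 ∧ c C7 = 0 ∧ c D7 = 0 ∧
  c A9 = 0 ∧ c B9 = 0 ∧ c C9₁ = 0 ∧ c C9₃ = 0 ∧
  c D9₁ = 0 ∧ c D9₂ = 0 ∧ c D9₃ = 0 ∧ c E9 = 0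

end Yoshida

/-! Write `S₂(t) = exp(∑ t^l α_l)` up to a given order. The palindromic form gives `S₂(t) S₂(-t) =
1`, so the logarithm is odd and only `α₁, α₃, …` survive; moreover `α₁ = ∑ X_j`. Everything then
rests on the induction step `exp V · exp L · exp V = exp L' + O(τ^11)` (`exp_expansion_step`), where
`V` is the logarithm of `S₂(vτ)` through order nine, `L` has the coefficients of index `m`, and `L'`
those produced by `step`.

No Baker–Campbell–Hausdorff formula is invoked. The step is equivalent to `exp L · exp V = exp(-V) ·
exp L'`, and both sides are compared as noncommutative series in letters of weight 1, 3, 5, 7, 9.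
For each word the two coefficients are explicit polynomials in `v` and the old coefficients, so
agreement is a finite list of ring identities. Only odd weights are checked this way
(`stepAgrees_of_odd`): `exp V · exp L · exp V` and `exp L'` are both inverted by `τ ↦ -τ`, and two
such functions cannot first differ at an even power (`eq_zero_of_even_of_eqMod`).

A local inverse of `exp` at `1` moves the `O(τ^11)` error into the exponent. Under the order
conditions the relation for `C9₂` removes the last coefficient, leaving `exp(τ α₁)`. -/

namespace Yoshida

/-! ### Calculus of functions modulo `O(τ^N)`, Taylor polynomials, and the local logarithm. -/

section Analysis

variable {𝔸 : Type*} [NormedRing 𝔸]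

/-- Agreement of two functions up to an error `O(τ ^ N)` at the origin. -/
def EqMod (N : ℕ) (f g : ℝ → 𝔸) : Prop :=
  (fun τ => f τ - g τ) =O[𝓝 0] fun τ : ℝ => τ ^ N

theorem EqMod.refl (N : ℕ) (f : ℝ → 𝔸) : EqMod N f f := by
  simpa [EqMod] using isBigO_zero _ _

theorem EqMod.of_eq {N : ℕ} {f g : ℝ → 𝔸} (h : ∀ τ, f τ = g τ) : EqMod N f g := by
  rw [funext h]; exact EqMod.refl N g

theorem EqMod.symm {N : ℕ} {f g : ℝ → 𝔸} (h : EqMod N f g) : EqMod N g f :=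
  h.neg_left.congr_left fun τ => by simp

theorem EqMod.trans {N : ℕ} {f g k : ℝ → 𝔸} (h : EqMod N f g) (h' : EqMod N g k) : EqMod N f k :=
  (IsBigO.add h h').congr_left fun τ => by simp

theorem EqMod.add {N : ℕ} {f g f' g' : ℝ → 𝔸} (h : EqMod N f g) (h' : EqMod N f' g') :
    EqMod N (fun τ => f τ + f' τ) (fun τ => g τ + g' τ) :=
  (IsBigO.add h h').congr_left fun _ => (add_sub_add_comm _ _ _ _).symm

theorem EqMod.sub {N : ℕ} {f g f' g' : ℝ → 𝔸} (h : EqMod N f g) (h' : EqMod N f' g') :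
    EqMod N (fun τ => f τ - f' τ) (fun τ => g τ - g' τ) :=
  (IsBigO.sub h h').congr_left fun _ => sub_sub_sub_comm _ _ _ _

theorem EqMod.sum {N : ℕ} {ι : Type*} {s : Finset ι} {f g : ι → ℝ → 𝔸}
    (h : ∀ i ∈ s, EqMod N (f i) (g i)) :
    EqMod N (fun τ => ∑ i ∈ s, f i τ) (fun τ => ∑ i ∈ s, g i τ) :=
  (IsBigO.fun_sum h).congr_left fun τ => by simp

/-- From `f f' - g g' = (f - g) f' + g (f' - g')`, which is why only `g` and `f'` need be bounded.
-/
theorem EqMod.mul {N : ℕ} {f g f' g' : ℝ → 𝔸} (h : EqMod N f g) (h' : EqMod N f' g')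
    (hg : g =O[𝓝 0] fun _ => (1 : ℝ)) (hf' : f' =O[𝓝 0] fun _ => (1 : ℝ)) :
    EqMod N (fun τ => f τ * f' τ) (fun τ => g τ * g' τ) := by
  have h₁ := IsBigO.mul h hf'
  have h₂ := IsBigO.mul hg h'
  simp only [mul_one, one_mul] at h₁ h₂
  exact (h₁.add h₂).congr_left fun τ => by noncomm_ring

theorem pow_isBigO_pow {m n : ℕ} (h : m ≤ n) :
    (fun τ : ℝ => τ ^ n) =O[𝓝 0] fun τ : ℝ => τ ^ m := by
  rcases h.eq_or_lt with rfl | h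
  · exact isBigO_refl _ _
  · exact (isLittleO_pow_pow h).isBigO

theorem pow_isBigO_one (n : ℕ) : (fun τ : ℝ => τ ^ n) =O[𝓝 0] fun _ : ℝ => (1 : ℝ) := by
  simpa using pow_isBigO_pow (Nat.zero_le n)

theorem EqMod.isBigO_one {N : ℕ} {f g : ℝ → 𝔸} (h : EqMod N f g)
    (hg : g =O[𝓝 0] fun _ => (1 : ℝ)) : f =O[𝓝 0] fun _ => (1 : ℝ) :=
  ((IsBigO.trans h (pow_isBigO_one N)).add hg).congr_left fun τ => by simp

theorem EqMod.tendsto {N : ℕ} (hN : N ≠ 0) {f g : ℝ → 𝔸} {a : 𝔸} (h : EqMod N f g)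
    (hg : Tendsto g (𝓝 0) (𝓝 a)) : Tendsto f (𝓝 0) (𝓝 a) := by
  have h₀ : Tendsto (fun τ : ℝ => τ ^ N) (𝓝 0) (𝓝 0) := by
    simpa [hN] using (continuous_pow N).tendsto (0 : ℝ)
  simpa using (IsBigO.trans_tendsto h h₀).add hg

theorem EqMod.comp_mul {N : ℕ} {f g : ℝ → 𝔸} (h : EqMod N f g) (v : ℝ) :
    EqMod N (fun τ => f (v * τ)) (fun τ => g (v * τ)) := by
  have ht : Tendsto (fun τ : ℝ => v * τ) (𝓝 0) (𝓝 0) := by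
    simpa using (continuous_const_mul v).tendsto (0 : ℝ)
  refine (IsBigO.comp_tendsto h ht).trans ?_
  simp only [Function.comp_def, mul_pow]
  exact isBigO_const_mul_self _ _ _

variable [NormedAlgebra ℝ 𝔸]

theorem EqMod.const_smul {N : ℕ} {f g : ℝ → 𝔸} (c : ℝ) (h : EqMod N f g) :
    EqMod N (fun τ => c • f τ) (fun τ => c • g τ) :=
  (h.const_smul_left c).congr_left fun τ => by simp [smul_sub]

theorem pow_smul_isBigO (n : ℕ) (a : 𝔸) :
    (fun τ : ℝ => τ ^ n • a) =O[𝓝 0] fun τ : ℝ => τ ^ n := by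
  simpa using (isBigO_refl (fun τ : ℝ => τ ^ n) (𝓝 0)).smul
    (isBigO_const_const a (one_ne_zero (α := ℝ)) (𝓝 0))

theorem eq_zero_of_pow_smul_isBigO {n : ℕ} {a : 𝔸}
    (h : (fun τ : ℝ => τ ^ n • a) =O[𝓝 0] fun τ : ℝ => τ ^ (n + 1)) : a = 0 := by
  have h' : (fun _ : ℝ => a) =O[𝓝[≠] 0] fun τ : ℝ => τ := by
    have h₁ := (isBigO_refl (fun τ : ℝ => (τ ^ n)⁻¹) (𝓝[≠] 0)).smul
      (h.mono nhdsWithin_le_nhds)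
    refine h₁.congr' ?_ ?_ <;>
    · filter_upwards [self_mem_nhdsWithin] with τ hτ
      have : τ ^ n ≠ 0 := pow_ne_zero _ hτ
      first
        | rw [smul_smul, inv_mul_cancel₀ this, one_smul]
        | rw [smul_eq_mul, pow_succ, inv_mul_cancel_left₀ this]
  have h₀ : Tendsto (fun τ : ℝ => τ) (𝓝[≠] 0) (𝓝 0) := tendsto_id.mono_left nhdsWithin_le_nhds
  exact tendsto_nhds_unique tendsto_const_nhds (h'.trans_tendsto h₀)

/-- Uniqueness of Taylor coefficients: below `n` the terms vanish by induction, above `n` they are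
`O(τ^(n+1))`, so `τ^n • d n` is itself `O(τ^(n+1))`. -/
theorem eq_zero_of_sum_isBigO {N : ℕ} {d : ℕ → 𝔸}
    (h : (fun τ : ℝ => ∑ n ∈ Finset.range N, τ ^ n • d n) =O[𝓝 0] fun τ : ℝ => τ ^ N) :
    ∀ n < N, d n = 0 := by
  intro n
  induction n using Nat.strong_induction_on with
  | _ n ih =>
    intro hn
    apply eq_zero_of_pow_smul_isBigO (n := n)
    have h₁ : (fun τ : ℝ => ∑ k ∈ (Finset.range N).erase n, τ ^ k • d k) =O[𝓝 0]
        fun τ : ℝ => τ ^ (n + 1) := by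
      refine IsBigO.fun_sum fun k hk => ?_
      obtain ⟨hkn, hk⟩ := Finset.mem_erase.1 hk
      rcases lt_or_gt_of_ne hkn with hlt | hgt
      · simpa [ih k hlt (Finset.mem_range.1 hk)] using isBigO_zero _ _
      · exact (pow_smul_isBigO k (d k)).trans (pow_isBigO_pow hgt)
    refine ((h.trans (pow_isBigO_pow hn)).sub h₁).congr_left fun τ => ?_
    rw [← Finset.add_sum_erase _ _ (Finset.mem_range.2 hn), add_sub_cancel_right]

/-- `f` has the Taylor polynomial of order `N` at the origin given by the power series `p`. -/
def HasTaylor (N : ℕ) (f : ℝ → 𝔸) (p : PowerSeries 𝔸) : Prop :=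
  EqMod N f fun τ => ∑ n ∈ Finset.range N, τ ^ n • PowerSeries.coeff n p

theorem HasTaylor.congr {N : ℕ} {f g : ℝ → 𝔸} {p : PowerSeries 𝔸} (h : HasTaylor N f p)
    (h' : EqMod N f g) : HasTaylor N g p :=
  h'.symm.trans h

theorem sum_pow_smul_isBigO_one (s : Finset ℕ) (d : ℕ → 𝔸) :
    (fun τ : ℝ => ∑ n ∈ s, τ ^ n • d n) =O[𝓝 0] fun _ => (1 : ℝ) :=
  IsBigO.fun_sum fun n _ => (pow_smul_isBigO n (d n)).trans (pow_isBigO_one n)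

theorem HasTaylor.isBigO_one {N : ℕ} {f : ℝ → 𝔸} {p : PowerSeries 𝔸} (h : HasTaylor N f p) :
    f =O[𝓝 0] fun _ => (1 : ℝ) :=
  EqMod.isBigO_one h (sum_pow_smul_isBigO_one _ _)

theorem HasTaylor.isBigO_pow {N : ℕ} {f : ℝ → 𝔸} {p : PowerSeries 𝔸} (h : HasTaylor N f p)
    {k : ℕ} (hk : k ≤ N) (hp : ∀ n < k, PowerSeries.coeff n p = 0) :
    f =O[𝓝 0] fun τ : ℝ => τ ^ k := by
  have h₁ : (fun τ : ℝ => ∑ n ∈ Finset.range N, τ ^ n • PowerSeries.coeff n p) =O[𝓝 0]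
      fun τ : ℝ => τ ^ k := by
    refine IsBigO.fun_sum fun n _ => ?_
    by_cases hn : n < k
    · simpa [hp n hn] using isBigO_zero _ _
    · exact (pow_smul_isBigO n _).trans (pow_isBigO_pow (not_lt.1 hn))
  exact ((IsBigO.trans h (pow_isBigO_pow hk)).add h₁).congr_left fun τ => by simp

theorem HasTaylor.sub {N : ℕ} {f g : ℝ → 𝔸} {p q : PowerSeries 𝔸} (h : HasTaylor N f p)
    (h' : HasTaylor N g q) : HasTaylor N (fun τ => f τ - g τ) (p - q) :=
  (EqMod.sub h h').trans (EqMod.of_eq fun τ => by simp [smul_sub])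

theorem HasTaylor.const_smul {N : ℕ} {f : ℝ → 𝔸} {p : PowerSeries 𝔸} (h : HasTaylor N f p)
    (c : ℝ) : HasTaylor N (fun τ => c • f τ) (c • p) :=
  (EqMod.const_smul c h).trans (EqMod.of_eq fun τ => by
    simp [Finset.smul_sum, smul_comm c])

theorem HasTaylor.sum {N : ℕ} {ι : Type*} {s : Finset ι} {f : ι → ℝ → 𝔸}
    {p : ι → PowerSeries 𝔸} (h : ∀ i ∈ s, HasTaylor N (f i) (p i)) :
    HasTaylor N (fun τ => ∑ i ∈ s, f i τ) (∑ i ∈ s, p i) :=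
  (EqMod.sum h).trans (EqMod.of_eq fun τ => by
    rw [Finset.sum_comm]; simp [Finset.smul_sum])

theorem HasTaylor.one {N : ℕ} : HasTaylor N (fun _ => (1 : 𝔸)) 1 := by
  rcases N with _ | N
  · simpa [HasTaylor, EqMod] using isBigO_const_const (1 : 𝔸) (one_ne_zero (α := ℝ)) (𝓝 (0 : ℝ))
  · refine EqMod.of_eq fun τ => ?_
    simp [PowerSeries.coeff_one]

theorem HasTaylor.mul {N : ℕ} {f g : ℝ → 𝔸} {p q : PowerSeries 𝔸} (h : HasTaylor N f p)
    (h' : HasTaylor N g q) : HasTaylor N (fun τ => f τ * g τ) (p * q) := by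
  refine (EqMod.mul h h' (sum_pow_smul_isBigO_one _ _) h'.isBigO_one).trans ?_
  -- The product of the truncations exceeds the truncated product exactly by the pairs of total
  -- degree at least `N`.
  have key (τ : ℝ) : (∑ n ∈ Finset.range N, τ ^ n • PowerSeries.coeff n p) *
        (∑ n ∈ Finset.range N, τ ^ n • PowerSeries.coeff n q) -
        ∑ n ∈ Finset.range N, τ ^ n • PowerSeries.coeff n (p * q) =
      ∑ x ∈ (Finset.range N ×ˢ Finset.range N).filter (fun x => ¬ x.1 + x.2 < N),
        τ ^ (x.1 + x.2) • (PowerSeries.coeff x.1 p * PowerSeries.coeff x.2 q) := by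
    rw [Finset.sum_mul_sum, ← Finset.sum_product', sub_eq_iff_eq_add,
      ← Finset.sum_filter_not_add_sum_filter _ (fun x : ℕ × ℕ => x.1 + x.2 < N)]
    congr 1
    · refine Finset.sum_congr rfl fun x _ => ?_
      rw [smul_mul_smul_comm, pow_add]
    · rw [Finset.sum_congr rfl (g := fun n => ∑ x ∈ Finset.HasAntidiagonal.antidiagonal n,
          τ ^ (x.1 + x.2) • (PowerSeries.coeff x.1 p * PowerSeries.coeff x.2 q))]
      · rw [Finset.sum_sigma']
        refine Finset.sum_bij' (fun x _ => ⟨x.1 + x.2, x⟩) (fun x _ => x.2) ?_ ?_ ?_ ?_ ?_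
        · simp
        · rintro ⟨n, x⟩ hx
          simp at hx ⊢
          omega
        · simp
        · rintro ⟨n, x⟩ hx
          simp at hx ⊢
          exact hx.2
        · intro x _
          rw [smul_mul_smul_comm, pow_add]
      · intro n _
        rw [PowerSeries.coeff_mul, Finset.smul_sum]
        exact Finset.sum_congr rfl fun x hx => by rw [Finset.HasAntidiagonal.mem_antidiagonal.1 hx]
  refine (IsBigO.congr_left ?_ fun τ => (key τ).symm)
  refine IsBigO.fun_sum fun x hx => ?_
  exact (pow_smul_isBigO _ _).trans (pow_isBigO_pow (not_lt.1 (Finset.mem_filter.1 hx).2))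

theorem HasTaylor.pow {N : ℕ} {f : ℝ → 𝔸} {p : PowerSeries 𝔸} (h : HasTaylor N f p) (k : ℕ) :
    HasTaylor N (fun τ => f τ ^ k) (p ^ k) := by
  induction k with
  | zero => simpa using HasTaylor.one
  | succ k ih => simpa only [pow_succ] using ih.mul h

theorem HasTaylor.list_prod {N : ℕ} {ι : Type*} (l : List ι) {f : ι → ℝ → 𝔸}
    {p : ι → PowerSeries 𝔸} (h : ∀ i, HasTaylor N (f i) (p i)) :
    HasTaylor N (fun τ => (l.map fun i => f i τ).prod) (l.map p).prod := by
  induction l with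
  | nil => simpa using HasTaylor.one
  | cons i l ih => simpa using (h i).mul ih

variable [CompleteSpace 𝔸]

theorem exp_eqMod_sum {N : ℕ} {g : ℝ → 𝔸} (hg : g =O[𝓝 0] fun τ : ℝ => τ) :
    EqMod N (fun τ => NormedSpace.exp (g τ))
      (fun τ => ∑ k ∈ Finset.range N, ((k.factorial : ℝ)⁻¹) • g τ ^ k) := by
  have h := (NormedSpace.exp_hasFPowerSeriesAt_zero (𝕂 := ℝ) (𝔸 := 𝔸)).isBigO_sub_partialSum_pow N
  have hg0 : Tendsto g (𝓝 0) (𝓝 0) := hg.trans_tendsto tendsto_id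
  have h' := (h.comp_tendsto hg0).trans ((hg.norm_left.pow N))
  refine h'.congr_left fun τ => ?_
  simp [FormalMultilinearSeries.partialSum, NormedSpace.expSeries_apply_eq]

theorem HasTaylor.exp_smul {N : ℕ} (y : 𝔸) :
    HasTaylor N (fun τ => NormedSpace.exp (τ • y)) (formalExp y) := by
  refine (exp_eqMod_sum ?_).trans (EqMod.of_eq fun τ => ?_)
  · simpa using pow_smul_isBigO 1 y
  · simp [formalExp, smul_pow, smul_comm (τ ^ _)]

/-- The inverse function theorem, as `exp` has strict derivative the identity at `0`. The Lipschitz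
bound in the third clause carries `O(τ^N)` estimates from exponentials to exponents. -/
theorem exists_local_log : ∃ L : 𝔸 → 𝔸, (∀ᶠ y in 𝓝 1, NormedSpace.exp (L y) = y) ∧
    (∀ᶠ x in 𝓝 0, L (NormedSpace.exp x) = x) ∧
    (fun p : 𝔸 × 𝔸 => L p.1 - L p.2) =O[𝓝 (1, 1)] fun p => p.1 - p.2 := by
  have h : HasStrictFDerivAt (NormedSpace.exp : 𝔸 → 𝔸)
      ((ContinuousLinearEquiv.refl ℝ 𝔸 : 𝔸 ≃L[ℝ] 𝔸) : 𝔸 →L[ℝ] 𝔸) 0 := hasStrictFDerivAt_exp_zero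
  have h₀ : NormedSpace.exp (0 : 𝔸) = 1 := NormedSpace.exp_zero
  refine ⟨h.localInverse _ _ _, ?_, ?_, ?_⟩
  · simpa [h₀] using h.eventually_right_inverse
  · exact h.eventually_left_inverse
  · simpa [h₀] using h.to_localInverse.isBigO_sub

theorem EqMod.exp {N : ℕ} {f g : ℝ → 𝔸} (h : EqMod N f g) (hf : Tendsto f (𝓝 0) (𝓝 0))
    (hg : Tendsto g (𝓝 0) (𝓝 0)) :
    EqMod N (fun τ => NormedSpace.exp (f τ)) (fun τ => NormedSpace.exp (g τ)) :=
  ((hasStrictFDerivAt_exp_zero (𝕂 := ℝ) (𝔸 := 𝔸)).isBigO_sub.comp_tendsto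
    (hf.prodMk_nhds hg)).trans h

theorem tendsto_exp_one {f : ℝ → 𝔸} (hf : Tendsto f (𝓝 0) (𝓝 0)) :
    Tendsto (fun τ => NormedSpace.exp (f τ)) (𝓝 0) (𝓝 1) := by
  let _ : NormedAlgebra ℚ 𝔸 := NormedAlgebra.restrictScalars ℚ ℝ 𝔸
  simpa using hf.exp

theorem exists_eq_exp_add {N : ℕ} (hN : N ≠ 0) {F P : ℝ → 𝔸} (hP : Tendsto P (𝓝 0) (𝓝 0))
    (h : EqMod N F fun τ => NormedSpace.exp (P τ)) :
    ∃ r : ℝ → 𝔸, r =O[𝓝 0] (fun τ : ℝ => τ ^ N) ∧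
      ∀ᶠ τ in 𝓝 (0 : ℝ), F τ = NormedSpace.exp (P τ + r τ) := by
  obtain ⟨L, hL₁, hL₂, hL₃⟩ := exists_local_log (𝔸 := 𝔸)
  have hE := tendsto_exp_one hP
  have hF := h.tendsto hN hE
  refine ⟨fun τ => L (F τ) - P τ, ?_, ?_⟩
  · refine IsBigO.congr' ((hL₃.comp_tendsto (hF.prodMk_nhds hE)).trans h) ?_ EventuallyEq.rfl
    filter_upwards [hP.eventually hL₂] with τ hτ
    simp [hτ]
  · filter_upwards [hF.eventually hL₁] with τ hτ
    simp [hτ]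

theorem EqMod.of_exp {N : ℕ} {f g : ℝ → 𝔸} (hf : Tendsto f (𝓝 0) (𝓝 0))
    (hg : Tendsto g (𝓝 0) (𝓝 0))
    (h : EqMod N (fun τ => NormedSpace.exp (f τ)) (fun τ => NormedSpace.exp (g τ))) :
    EqMod N f g := by
  obtain ⟨L, -, hL₂, hL₃⟩ := exists_local_log (𝔸 := 𝔸)
  refine IsBigO.congr' ((hL₃.comp_tendsto
    ((tendsto_exp_one hf).prodMk_nhds (tendsto_exp_one hg))).trans h) ?_ EventuallyEq.rfl
  filter_upwards [hf.eventually hL₂, hg.eventually hL₂] with τ h₁ h₂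
  simp [h₁, h₂]

end Analysis

end Yoshida

namespace Yoshida

/-! ### The truncated logarithm inverts the exponential modulo high powers. -/

section LogExp

theorem isBigO_const_smul {𝔸 : Type*} [NormedRing 𝔸] [NormedAlgebra ℝ 𝔸] {f : ℝ → 𝔸} {g : ℝ → ℝ}
    (c : ℝ) (h : f =O[𝓝 0] g) : (fun τ => c • f τ) =O[𝓝 0] g :=
  h.const_smul_left c

open Polynomial in
-- Turns a real-variable estimate into an algebraic divisibility, which can then be evaluated in any
-- real algebra.
theorem X_pow_dvd_of_eval_isBigO {p : ℝ[X]} {N : ℕ}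
    (h : (fun x : ℝ => p.eval x) =O[𝓝 0] fun x : ℝ => x ^ N) : X ^ N ∣ p := by
  rw [Polynomial.X_pow_dvd_iff]
  refine eq_zero_of_sum_isBigO (d := p.coeff) ?_
  have h₁ : (fun x : ℝ => ∑ n ∈ p.support.filter (fun n => ¬ n < N), x ^ n • p.coeff n) =O[𝓝 0]
      fun x : ℝ => x ^ N :=
    IsBigO.fun_sum fun n hn =>
      (pow_smul_isBigO n _).trans (pow_isBigO_pow (not_lt.1 (Finset.mem_filter.1 hn).2))
  refine (h.sub h₁).congr_left fun x => ?_
  rw [Polynomial.eval_eq_sum, Polynomial.sum_def,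
    ← Finset.sum_filter_add_sum_filter_not _ (fun n : ℕ => n < N)]
  simp only [smul_eq_mul, mul_comm (p.coeff _), add_sub_cancel_right]
  refine Finset.sum_subset_zero_on_sdiff (fun n hn => ?_) (fun n hn => ?_) fun _ _ => rfl
  · exact Finset.mem_range.2 (Finset.mem_filter.1 hn).2
  · simp only [Finset.mem_sdiff, Finset.mem_range, Finset.mem_filter, Polynomial.mem_support_iff,
      not_and] at hn
    have : p.coeff n = 0 := by
      by_contra h0
      exact hn.2 h0 hn.1
    simp [this]

open Polynomial in
/-- The truncated series of `log (1 + X)`. -/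
noncomputable def logPoly (N : ℕ) : ℝ[X] :=
  ∑ k ∈ Finset.Ico 1 N, ((-1 : ℝ) ^ (k + 1) / (k : ℝ)) • X ^ k

open Polynomial in
/-- The truncated exponential series. -/
noncomputable def expPoly (N : ℕ) : ℝ[X] :=
  ∑ k ∈ Finset.range N, ((k.factorial : ℝ)⁻¹) • X ^ k

theorem eval_logPoly_eqMod (N : ℕ) :
    EqMod N (fun x => (logPoly N).eval x) (fun x => Real.log (1 + x)) := by
  rcases N with _ | N
  · have h : ContinuousAt (fun x : ℝ => (logPoly 0).eval x - Real.log (1 + x)) 0 :=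
      (Polynomial.continuous _).continuousAt.sub (ContinuousAt.log (by fun_prop) (by simp))
    simpa only [pow_zero] using! h.isBigO_one ℝ
  refine IsBigO.of_bound 2 ?_
  have hnhds : ∀ᶠ x : ℝ in 𝓝 0, |x| < 1 / 2 := by
    have : Tendsto (fun x : ℝ => |x|) (𝓝 0) (𝓝 0) := by
      simpa using (continuous_abs.tendsto (0 : ℝ))
    exact this.eventually (gt_mem_nhds (by norm_num))
  filter_upwards [hnhds] with x hx
  -- The remainder bound is `|x|^(N+1) / (1 - |x|)`; `|x| < 1/2` yields the constant `2`.
  have h := Real.abs_log_sub_add_sum_range_le (x := -x) (by rw [abs_neg]; linarith) N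
  have hs : (logPoly (N + 1)).eval x = -∑ i ∈ Finset.range N, (-x) ^ (i + 1) / ((i : ℝ) + 1) := by
    rw [logPoly, Polynomial.eval_finsetSum, Finset.sum_Ico_eq_sum_range, Nat.add_sub_cancel,
      ← Finset.sum_neg_distrib]
    refine Finset.sum_congr rfl fun i _ => ?_
    simp only [Polynomial.eval_smul, Polynomial.eval_pow, Polynomial.eval_X, smul_eq_mul]
    rw [neg_pow x, add_comm 1 i]
    push_cast
    ring
  rw [hs, Real.norm_eq_abs, Real.norm_eq_abs, ← abs_neg, abs_pow]
  rw [abs_neg, sub_neg_eq_add] at h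
  calc _ = _ := by congr 1; ring
    _ ≤ _ := h
    _ ≤ 2 * |x| ^ (N + 1) := by
      rw [div_le_iff₀ (by linarith)]
      nlinarith [pow_nonneg (abs_nonneg x) (N + 1)]

theorem isBigO_pow_of_isBigO {𝔸 : Type*} [NormedRing 𝔸] {u : ℝ → 𝔸} {g : ℝ → ℝ}
    (hu : u =O[𝓝 0] g) {k : ℕ} (hk : 0 < k) : (fun τ => u τ ^ k) =O[𝓝 0] fun τ => g τ ^ k :=
  (IsBigO.of_bound 1 (Eventually.of_forall fun τ => by
    simpa using norm_pow_le' (u τ) hk)).trans (hu.norm_left.pow k)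

theorem aeval_isBigO_one {𝔸 : Type*} [NormedRing 𝔸] [NormedAlgebra ℝ 𝔸] (p : Polynomial ℝ)
    {u : ℝ → 𝔸} (hu : u =O[𝓝 0] fun _ => (1 : ℝ)) :
    (fun τ => Polynomial.aeval (u τ) p) =O[𝓝 0] fun _ => (1 : ℝ) := by
  simp only [Polynomial.aeval_eq_sum_range]
  refine IsBigO.fun_sum fun k _ => isBigO_const_smul _ ?_
  rcases k with _ | k
  · simpa using isBigO_const_const (1 : 𝔸) (one_ne_zero (α := ℝ)) (𝓝 (0 : ℝ))
  · simpa using isBigO_pow_of_isBigO hu k.succ_pos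

open Polynomial in
-- Read off from the scalar identity `exp (log (1 + x)) = 1 + x`, so that no combinatorics of series
-- coefficients is needed.
theorem X_pow_dvd_expPoly_comp_logPoly (N : ℕ) :
    X ^ N ∣ (expPoly N).comp (logPoly N) - (1 + X) := by
  refine X_pow_dvd_of_eval_isBigO ?_
  have hlog : ContinuousAt (fun x : ℝ => Real.log (1 + x)) 0 :=
    ContinuousAt.log (by fun_prop) (by simp)
  have h₁ : (fun x : ℝ => (logPoly N).eval x) =O[𝓝 0] fun x : ℝ => x := by
    simp only [logPoly, eval_finsetSum, eval_smul, eval_pow, eval_X]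
    refine IsBigO.fun_sum fun k hk => isBigO_const_smul _ ?_
    simpa using pow_isBigO_pow (Finset.mem_Ico.1 hk).1
  have h₂ : Tendsto (fun x : ℝ => (logPoly N).eval x) (𝓝 0) (𝓝 0) := h₁.trans_tendsto tendsto_id
  have h₃ : Tendsto (fun x : ℝ => Real.log (1 + x)) (𝓝 0) (𝓝 0) := by simpa using hlog.tendsto
  have h := (exp_eqMod_sum (N := N) h₁).symm.trans ((eval_logPoly_eqMod N).exp h₂ h₃)
  refine IsBigO.congr' h ?_ EventuallyEq.rfl
  filter_upwards [lt_mem_nhds (show (-1 : ℝ) < 0 by norm_num)] with x hx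
  rw [← Real.exp_eq_exp_ℝ, Real.exp_log (by linarith)]
  simp [expPoly, eval_finsetSum]

theorem exp_aeval_logPoly {𝔸 : Type*} [NormedRing 𝔸] [NormedAlgebra ℝ 𝔸] [CompleteSpace 𝔸]
    {N : ℕ} (hN : 2 ≤ N) {u : ℝ → 𝔸} (hu : u =O[𝓝 0] fun τ : ℝ => τ) :
    EqMod N (fun τ => NormedSpace.exp (Polynomial.aeval (u τ) (logPoly N))) fun τ => 1 + u τ := by
  have hu1 : u =O[𝓝 0] fun _ => (1 : ℝ) := by
    exact hu.trans (by simpa only [pow_one] using pow_isBigO_one 1)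
  have h₁ : (fun τ => Polynomial.aeval (u τ) (logPoly N)) =O[𝓝 0] fun τ : ℝ => τ := by
    simp only [logPoly, map_sum, map_smul, map_pow, Polynomial.aeval_X]
    refine IsBigO.fun_sum fun k hk => isBigO_const_smul _ ?_
    have hk₁ := (Finset.mem_Ico.1 hk).1
    simpa only [pow_one] using (isBigO_pow_of_isBigO hu hk₁).trans (pow_isBigO_pow hk₁)
  obtain ⟨R, hR⟩ := X_pow_dvd_expPoly_comp_logPoly N
  refine (exp_eqMod_sum h₁).trans ?_
  have h₃ := isBigO_pow_of_isBigO hu (show 0 < N by omega)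
  have h₄ := h₃.mul (aeval_isBigO_one R hu1)
  simp only [mul_one] at h₄
  refine h₄.congr_left fun τ => ?_
  have := congrArg (Polynomial.aeval (u τ)) hR
  simp only [map_sub, map_add, map_one, map_mul, map_pow, Polynomial.aeval_X] at this
  rw [← this, Polynomial.aeval_comp]
  simp [expPoly]

end LogExp

/-! ### The logarithm of `S₂`: its Taylor coefficients, its linear term, and its oddness. -/

section SecondOrder

variable {𝔸 : Type*} [NormedRing 𝔸] [NormedAlgebra ℝ 𝔸]

theorem constantCoeff_formalExp (x : 𝔸) : PowerSeries.constantCoeff (formalExp x) = 1 := by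
  rw [← PowerSeries.coeff_zero_eq_constantCoeff_apply]
  simp [formalExp]

theorem powerSeries_constantCoeff_list_prod {R : Type*} [Semiring R] {l : List (PowerSeries R)}
    (h : ∀ p ∈ l, PowerSeries.constantCoeff p = 1) : PowerSeries.constantCoeff l.prod = 1 := by
  induction l with
  | nil => simp
  | cons p l ih =>
    rw [List.forall_mem_cons] at h
    simp [h.1, ih h.2]

theorem powerSeries_coeff_one_mul_of_constantCoeff {R : Type*} [Semiring R] {p q : PowerSeries R}
    (hp : PowerSeries.constantCoeff p = 1) (hq : PowerSeries.constantCoeff q = 1) :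
    PowerSeries.coeff 1 (p * q) = PowerSeries.coeff 1 p + PowerSeries.coeff 1 q := by
  rw [PowerSeries.coeff_mul]
  simp [Finset.Nat.antidiagonal_succ, hp, hq, add_comm]

theorem powerSeries_coeff_one_list_prod {R : Type*} [Semiring R] {l : List (PowerSeries R)}
    (h : ∀ p ∈ l, PowerSeries.constantCoeff p = 1) :
    PowerSeries.coeff 1 l.prod = (l.map (PowerSeries.coeff 1)).sum := by
  induction l with
  | nil => simp [PowerSeries.coeff_one]
  | cons p l ih =>
    rw [List.forall_mem_cons] at h
    rw [List.prod_cons, powerSeries_coeff_one_mul_of_constantCoeff h.1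
      (powerSeries_constantCoeff_list_prod h.2), ih h.2, List.map_cons, List.sum_cons]

theorem constantCoeff_formalS₂ {J : ℕ} (X : Fin J → 𝔸) :
    PowerSeries.constantCoeff (formalS₂ X) = 1 := by
  rw [formalS₂, map_mul, powerSeries_constantCoeff_list_prod, powerSeries_constantCoeff_list_prod,
    one_mul]
  all_goals simp [List.mem_ofFn, constantCoeff_formalExp]

theorem α_one {J : ℕ} (X : Fin J → 𝔸) : α X 1 = ∑ j, X j := by
  have h (l : List (PowerSeries 𝔸)) (hl : l = List.ofFn fun j => formalExp ((1 / 2 : ℝ) • X j)) :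
      ∀ p ∈ l, PowerSeries.constantCoeff p = 1 := by
    subst hl
    simp [List.mem_ofFn, constantCoeff_formalExp]
  have h' := h _ rfl
  have h'' : ∀ p ∈ (List.ofFn fun j => formalExp ((1 / 2 : ℝ) • X j)).reverse,
      PowerSeries.constantCoeff p = 1 := fun p hp => h' p (List.mem_reverse.1 hp)
  have hc (x : 𝔸) : PowerSeries.coeff 1 (formalExp x) = x := by simp [formalExp]
  have : α X 1 = PowerSeries.coeff 1 (formalS₂ X) := by
    simp [α, PowerSeries.coeff_one]
  rw [this, formalS₂, powerSeries_coeff_one_mul_of_constantCoeff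
    (powerSeries_constantCoeff_list_prod h'') (powerSeries_constantCoeff_list_prod h'),
    powerSeries_coeff_one_list_prod h', powerSeries_coeff_one_list_prod h'', List.map_reverse,
    List.sum_reverse, List.map_ofFn, List.sum_ofFn, ← Finset.sum_add_distrib]
  refine Finset.sum_congr rfl fun j _ => ?_
  rw [Function.comp_apply, hc, ← add_smul]
  norm_num

theorem coeff_pow_eq_zero {R : Type*} [Semiring R] {p : PowerSeries R}
    (hp : PowerSeries.constantCoeff p = 0) {n k : ℕ} (h : n < k) :
    PowerSeries.coeff n (p ^ k) = 0 := by
  obtain ⟨q, rfl⟩ := PowerSeries.X_dvd_iff.2 hp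
  rw [(PowerSeries.commute_X q).symm.mul_pow, PowerSeries.coeff_X_pow_mul', if_neg (not_le.2 h)]

/-- Powers `k > l` of a series without constant term do not reach degree `l`, so one truncation `N`
serves all `l < N`. -/
theorem coeff_log_formalS₂ {J : ℕ} (X : Fin J → 𝔸) {N l : ℕ} (hl : l < N) :
    PowerSeries.coeff l (∑ k ∈ Finset.Ico 1 N,
      ((-1 : ℝ) ^ (k + 1) / (k : ℝ)) • (formalS₂ X - 1) ^ k) = α X l := by
  simp only [map_sum, α, PowerSeries.coeff_smul]
  symm
  refine Finset.sum_subset (fun k hk => ?_) fun k hk hk' => ?_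
  · simp only [Finset.mem_Icc, Finset.mem_Ico] at hk ⊢
    omega
  · simp only [Finset.mem_Icc, Finset.mem_Ico] at hk hk'
    rw [coeff_pow_eq_zero (by simp [constantCoeff_formalS₂]) (by omega), smul_zero]

variable [CompleteSpace 𝔸]

theorem hasTaylor_S₂ {J : ℕ} (X : Fin J → 𝔸) (N : ℕ) : HasTaylor N (S₂ X) (formalS₂ X) := by
  have h (j : Fin J) : HasTaylor N (fun τ => NormedSpace.exp ((τ / 2) • X j))
      (formalExp ((1 / 2 : ℝ) • X j)) := by
    convert HasTaylor.exp_smul ((1 / 2 : ℝ) • X j) using 3 with τ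
    rw [smul_smul, mul_one_div]
  have := (HasTaylor.list_prod (List.finRange J).reverse h).mul
    (HasTaylor.list_prod (List.finRange J) h)
  simpa only [List.map_reverse, ← List.ofFn_eq_map] using! this

theorem S₂_neg_mul {J : ℕ} (X : Fin J → 𝔸) (t : ℝ) : S₂ X t * S₂ X (-t) = 1 := by
  let _ : NormedAlgebra ℚ 𝔸 := NormedAlgebra.restrictScalars ℚ ℝ 𝔸
  have h₀ (s : ℝ) (x : 𝔸) : NormedSpace.exp (s • x) * NormedSpace.exp ((-s) • x) = 1 := by
    rw [← NormedSpace.exp_add_of_commute ((Commute.refl x).smul_left s |>.smul_right (-s)),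
      ← add_smul, add_neg_cancel, zero_smul, NormedSpace.exp_zero]
  have key (l : List 𝔸) (s : ℝ) : (l.map fun x => NormedSpace.exp (s • x)).prod *
      (l.map fun x => NormedSpace.exp ((-s) • x)).reverse.prod = 1 := by
    induction l with
    | nil => simp
    | cons x l ih =>
      simp only [List.map_cons, List.prod_cons, List.reverse_cons, List.prod_append,
        List.prod_nil, mul_one]
      rw [mul_assoc, ← mul_assoc (List.prod _), ih, one_mul, h₀]
  have key' (l : List 𝔸) (s : ℝ) : (l.map fun x => NormedSpace.exp (s • x)).reverse.prod *
      (l.map fun x => NormedSpace.exp ((-s) • x)).prod = 1 := by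
    simpa [List.map_reverse] using key l.reverse s
  have e (s : ℝ) : (List.ofFn fun j => NormedSpace.exp (s • X j)) =
      (List.ofFn X).map fun x => NormedSpace.exp (s • x) := by
    simp [List.map_ofFn, Function.comp_def]
  rw [S₂, S₂, neg_div, e, e, mul_assoc, ← mul_assoc (List.prod _) (List.prod _) (List.prod _), key, one_mul, key']

/-- The Taylor polynomial of the logarithm of `S₂`, up to order `N - 1`. -/
theorem S₂_eqMod_exp {J : ℕ} (X : Fin J → 𝔸) {N : ℕ} (hN : 2 ≤ N) :
    EqMod N (S₂ X) fun τ => NormedSpace.exp (∑ l ∈ Finset.range N, τ ^ l • α X l) := by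
  have hS := hasTaylor_S₂ X N
  have hu := hS.sub HasTaylor.one
  have hu' := hu.isBigO_pow (k := 1) (by omega) fun n hn => by
    obtain rfl : n = 0 := by omega
    simp [constantCoeff_formalS₂]
  simp only [pow_one] at hu'
  have h₁ := exp_aeval_logPoly hN hu'
  have h₂ : HasTaylor N (fun τ => Polynomial.aeval (S₂ X τ - 1) (logPoly N))
      (∑ k ∈ Finset.Ico 1 N, ((-1 : ℝ) ^ (k + 1) / (k : ℝ)) • (formalS₂ X - 1) ^ k) := by
    simp only [logPoly, map_sum, map_smul, map_pow, Polynomial.aeval_X]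
    exact HasTaylor.sum fun k _ => (hu.pow k).const_smul _
  have h₃ : EqMod N (fun τ => Polynomial.aeval (S₂ X τ - 1) (logPoly N))
      fun τ => ∑ l ∈ Finset.range N, τ ^ l • α X l :=
    EqMod.trans h₂ (EqMod.of_eq fun τ => Finset.sum_congr rfl fun l hl => by
      rw [coeff_log_formalS₂ X (Finset.mem_range.1 hl)])
  have h₄ : Tendsto (fun τ : ℝ => ∑ l ∈ Finset.range N, τ ^ l • α X l) (𝓝 0) (𝓝 0) := by
    have : Continuous fun τ : ℝ => ∑ l ∈ Finset.range N, τ ^ l • α X l := by fun_prop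
    convert this.tendsto 0
    obtain ⟨M, rfl⟩ : ∃ M, N = M + 1 := ⟨N - 1, by omega⟩
    -- At `τ = 0` only `l = 0` is left, and `α X 0` is an empty sum.
    simp [Finset.sum_range_succ', α]
  refine ((h₃.exp (h₃.tendsto (by omega) h₄) h₄).symm.trans (h₁.trans ?_)).symm
  exact EqMod.of_eq fun τ => by simp

/-- Time symmetry gives `P(-τ) = -P(τ)` modulo `τ^N` for the truncated logarithm `P`; comparing
coefficients at an even `l` leaves `2 α_l = 0`. -/
theorem α_even {J : ℕ} (X : Fin J → 𝔸) {l : ℕ} (hl : Even l) : α X l = 0 := by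
  let _ : NormedAlgebra ℚ 𝔸 := NormedAlgebra.restrictScalars ℚ ℝ 𝔸
  set N := l + 2
  set P : ℝ → 𝔸 := fun τ => ∑ l ∈ Finset.range N, τ ^ l • α X l with hP
  have hPc : Continuous P := by fun_prop
  have hP0 : P 0 = 0 := by simp [hP, N, Finset.sum_range_succ', α]
  have hPt : Tendsto P (𝓝 0) (𝓝 0) := by simpa [hP0] using hPc.tendsto 0
  have hneg : Tendsto (fun τ : ℝ => P (-τ)) (𝓝 0) (𝓝 0) := by
    simpa [hP0, Function.comp_def] using (hPc.comp continuous_neg).tendsto 0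
  have hPn : Tendsto (fun τ : ℝ => -P τ) (𝓝 0) (𝓝 0) := by simpa using hPt.neg
  have hS : EqMod N (S₂ X) fun τ => NormedSpace.exp (P τ) := S₂_eqMod_exp X (by omega)
  have hSn : EqMod N (fun τ => S₂ X (-τ)) fun τ => NormedSpace.exp (P (-τ)) := by
    simpa using hS.comp_mul (-1)
  have hSnb : (fun τ => S₂ X (-τ)) =O[𝓝 0] fun _ => (1 : ℝ) :=
    hSn.isBigO_one ((tendsto_exp_one hneg).isBigO_one ℝ)
  have hSb : S₂ X =O[𝓝 0] fun _ => (1 : ℝ) :=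
    hS.isBigO_one ((tendsto_exp_one hPt).isBigO_one ℝ)
  have hEn : (fun τ => NormedSpace.exp (-P τ)) =O[𝓝 0] fun _ => (1 : ℝ) :=
    (tendsto_exp_one hPn).isBigO_one ℝ
  have h₁ := (EqMod.refl N fun τ => NormedSpace.exp (-P τ)).mul
    (hS.mul (EqMod.refl N fun τ => S₂ X (-τ)) ((tendsto_exp_one hPt).isBigO_one ℝ) hSnb)
    hEn (by simpa using hSb.mul hSnb)
  -- Insert `1 = S₂(τ) S₂(-τ)` after `exp(-P)` and replace `S₂(τ)` by `exp P`, which cancels.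
  have h₂ : EqMod N (fun τ => NormedSpace.exp (-P τ)) fun τ => S₂ X (-τ) := by
    convert h₁ using 2 with τ τ
    · rw [S₂_neg_mul, mul_one]
    · rw [← mul_assoc, ← NormedSpace.exp_add_of_commute (Commute.refl (P τ)).neg_left,
        neg_add_cancel, NormedSpace.exp_zero, one_mul]
  have h₃ := EqMod.of_exp hneg hPn (h₂.trans hSn).symm
  have h₄ := eq_zero_of_sum_isBigO (N := N) (d := fun l => (-1 : ℝ) ^ l • α X l + α X l)
    (h₃.congr_left fun τ => by
      simp only [hP, sub_neg_eq_add, ← Finset.sum_add_distrib, smul_add, smul_smul]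
      refine Finset.sum_congr rfl fun l _ => ?_
      rw [neg_pow, mul_comm]) l (by omega)
  rw [hl.neg_one_pow, one_smul, ← two_smul ℝ] at h₄
  exact (smul_eq_zero_iff_right two_ne_zero).1 h₄

end SecondOrder

end Yoshida

namespace Yoshida

open Idx

/-! ### Noncommutative series as computable coefficient functions on words. -/

section Words

/-- Noncommutative polynomials without constant term as tries: `node j x sub next` stands for
`xⱼ * (x + sub) + next`, where `xⱼ` is the `j`-th letter. -/
inductive WordTree
  | nil
  | node (j : ℕ) (x : ℝ) (sub next : WordTree)

/-- The product of a trie with a noncommutative series given by its coefficients. -/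
def WordTree.mul : WordTree → (List ℕ → ℝ) → List ℕ → ℝ
  | .nil, _, _ => 0
  | .node _ _ _ _, _, [] => 0
  | .node j x sub next, q, i :: w =>
    (if i = j then x * q w + sub.mul q w else 0) + next.mul q (i :: w)

/-- The product of `∑ i < n, tⁱ / (k + i)!` with a noncommutative series, in Horner form. -/
noncomputable def WordTree.expMul (t : WordTree) (q : List ℕ → ℝ) : ℕ → ℕ → List ℕ → ℝ
  | _, 0, _ => 0
  | k, n + 1, w => (k.factorial : ℝ)⁻¹ * q w + t.mul (t.expMul q (k + 1) n) w

/-- The noncommutative series `1`. -/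
def wordOne : List ℕ → ℝ
  | [] => 1
  | _ :: _ => 0

/-- The words of weight `n`, the letter `j` having weight `2 j + 1`. -/
def words : ℕ → List (List ℕ)
  | 0 => [[]]
  | n + 1 => (List.range (n / 2 + 1)).flatMap fun j => (words (n - 2 * j)).map (j :: ·)
termination_by n => n

variable {𝔸 : Type*} [NormedRing 𝔸] [NormedAlgebra ℝ 𝔸]

/-- The value of a trie at the letters `τ ^ (2 j + 1) • a (2 j + 1)`. -/
noncomputable def WordTree.eval (a : ℕ → 𝔸) (τ : ℝ) : WordTree → 𝔸
  | .nil => 0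
  | .node j x sub next =>
    τ ^ (2 * j + 1) • (a (2 * j + 1) * (x • 1 + sub.eval a τ)) + next.eval a τ

/-- The part of weight `n` of a noncommutative series, evaluated at the letters `a (2 j + 1)`. -/
noncomputable def wordCoeff (a : ℕ → 𝔸) (p : List ℕ → ℝ) : ℕ → 𝔸
  | 0 => p [] • 1
  | n + 1 => ∑ j ∈ Finset.range (n / 2 + 1),
      a (2 * j + 1) * wordCoeff a (fun w => p (j :: w)) (n - 2 * j)
termination_by n => n

theorem wordCoeff_zero (a : ℕ → 𝔸) (p : List ℕ → ℝ) : wordCoeff a p 0 = p [] • 1 := by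
  rw [wordCoeff]

theorem wordCoeff_succ (a : ℕ → 𝔸) (p : List ℕ → ℝ) (n : ℕ) :
    wordCoeff a p (n + 1) = ∑ j ∈ Finset.range (n / 2 + 1),
      a (2 * j + 1) * wordCoeff a (fun w => p (j :: w)) (n - 2 * j) := by
  rw [wordCoeff]

theorem words_succ (n : ℕ) : words (n + 1) =
    (List.range (n / 2 + 1)).flatMap fun j => (words (n - 2 * j)).map (j :: ·) := by
  rw [words]

/-- Reduces an equality in `𝔸` to finitely many equalities of real numbers. -/
theorem wordCoeff_congr (a : ℕ → 𝔸) (n : ℕ) {p q : List ℕ → ℝ} (h : ∀ w ∈ words n, p w = q w) :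
    wordCoeff a p n = wordCoeff a q n := by
  induction n using Nat.strong_induction_on generalizing p q with
  | _ n ih =>
    rcases n with _ | n
    · rw [wordCoeff_zero, wordCoeff_zero, h [] (by simp [words])]
    · rw [wordCoeff_succ, wordCoeff_succ]
      refine Finset.sum_congr rfl fun j hj => ?_
      rw [ih (n - 2 * j) (by omega) fun w hw => h (j :: w) ?_]
      rw [words_succ]
      exact List.mem_flatMap.2 ⟨j, List.mem_range.2 (Finset.mem_range.1 hj),
        List.mem_map.2 ⟨w, hw, rfl⟩⟩

theorem wordCoeff_add (a : ℕ → 𝔸) (n : ℕ) (p q : List ℕ → ℝ) :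
    wordCoeff a (fun w => p w + q w) n = wordCoeff a p n + wordCoeff a q n := by
  induction n using Nat.strong_induction_on generalizing p q with
  | _ n ih =>
    rcases n with _ | n
    · simp only [wordCoeff_zero, add_smul]
    · simp only [wordCoeff_succ, ← Finset.sum_add_distrib, ← mul_add]
      exact Finset.sum_congr rfl fun j _ => by rw [ih (n - 2 * j) (by omega)]

theorem wordCoeff_const_mul (a : ℕ → 𝔸) (n : ℕ) (c : ℝ) (p : List ℕ → ℝ) :
    wordCoeff a (fun w => c * p w) n = c • wordCoeff a p n := by
  induction n using Nat.strong_induction_on generalizing p with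
  | _ n ih =>
    rcases n with _ | n
    · simp only [wordCoeff_zero, mul_smul]
    · simp only [wordCoeff_succ, Finset.smul_sum]
      exact Finset.sum_congr rfl fun j _ => by rw [ih (n - 2 * j) (by omega), mul_smul_comm]

theorem wordCoeff_fun_zero (a : ℕ → 𝔸) (n : ℕ) : wordCoeff a (fun _ => 0) n = 0 := by
  simpa using wordCoeff_const_mul a n 0 fun _ => 0

/-- The part of weight less than `N` of a noncommutative series, evaluated at the letters
`τ ^ (2 j + 1) • a (2 j + 1)`. -/
noncomputable def wordSum (N : ℕ) (a : ℕ → 𝔸) (p : List ℕ → ℝ) (τ : ℝ) : 𝔸 :=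
  ∑ n ∈ Finset.range N, τ ^ n • wordCoeff a p n

theorem wordSum_add (N : ℕ) (a : ℕ → 𝔸) (p q : List ℕ → ℝ) (τ : ℝ) :
    wordSum N a (fun w => p w + q w) τ = wordSum N a p τ + wordSum N a q τ := by
  simp only [wordSum, wordCoeff_add, smul_add, Finset.sum_add_distrib]

theorem wordSum_const_mul (N : ℕ) (a : ℕ → 𝔸) (c : ℝ) (p : List ℕ → ℝ) (τ : ℝ) :
    wordSum N a (fun w => c * p w) τ = c • wordSum N a p τ := by
  simp only [wordSum, wordCoeff_const_mul, Finset.smul_sum, smul_comm c]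

theorem wordSum_fun_zero (N : ℕ) (a : ℕ → 𝔸) (τ : ℝ) : wordSum N a (fun _ => 0) τ = 0 := by
  simp [wordSum, wordCoeff_fun_zero]

theorem wordSum_isBigO_one (N : ℕ) (a : ℕ → 𝔸) (p : List ℕ → ℝ) :
    wordSum N a p =O[𝓝 0] fun _ => (1 : ℝ) :=
  sum_pow_smul_isBigO_one _ _

/-- Multiplication of a noncommutative series by the letter `j` from the left. -/
def consMul (j : ℕ) (p : List ℕ → ℝ) : List ℕ → ℝ
  | [] => 0
  | i :: w => if i = j then p w else 0

theorem wordCoeff_consMul (a : ℕ → 𝔸) (j : ℕ) (p : List ℕ → ℝ) (n : ℕ) :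
    wordCoeff a (consMul j p) n =
      if 2 * j + 1 ≤ n then a (2 * j + 1) * wordCoeff a p (n - (2 * j + 1)) else 0 := by
  rcases n with _ | n
  · simp [wordCoeff_zero, consMul]
  rw [wordCoeff_succ]
  have h (i : ℕ) : wordCoeff a (fun w => consMul j p (i :: w)) (n - 2 * i) =
      if i = j then wordCoeff a p (n - 2 * i) else 0 := by
    split_ifs with hij
    · simp [consMul, hij]
    · simp [consMul, hij, wordCoeff_fun_zero]
  simp only [h, mul_ite, mul_zero, Finset.sum_ite_eq', Finset.mem_range]
  refine if_congr (by omega) ?_ rfl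
  rw [show n + 1 - (2 * j + 1) = n - 2 * j by omega]

/-- Only an equality modulo `τ^N`: the letter raises the weight by `2 j + 1` and pushes some terms
past the truncation. -/
theorem wordSum_consMul (N : ℕ) (a : ℕ → 𝔸) (j : ℕ) (p : List ℕ → ℝ) :
    EqMod N (fun τ => τ ^ (2 * j + 1) • (a (2 * j + 1) * wordSum N a p τ))
      (wordSum N a (consMul j p)) := by
  set d := 2 * j + 1
  have key (τ : ℝ) : wordSum N a (consMul j p) τ =
      ∑ n ∈ (Finset.range N).filter (fun n => n + d < N),
        τ ^ (n + d) • (a d * wordCoeff a p n) := by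
    simp only [wordSum, wordCoeff_consMul, smul_ite, smul_zero]
    rw [← Finset.sum_filter]
    refine Finset.sum_nbij' (fun n => n - d) (fun n => n + d) ?_ ?_ ?_ ?_ ?_
    · intro n hn; simp at hn ⊢; omega
    · intro n hn; simp at hn ⊢; omega
    · intro n hn; simp at hn ⊢; omega
    · intro n hn; simp
    · intro n hn
      simp only [Finset.mem_filter] at hn
      rw [Nat.sub_add_cancel hn.2]
  have h : (fun τ : ℝ => ∑ n ∈ (Finset.range N).filter (fun n => ¬ n + d < N),
      τ ^ (n + d) • (a d * wordCoeff a p n)) =O[𝓝 0] fun τ : ℝ => τ ^ N :=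
    IsBigO.fun_sum fun n hn =>
      (pow_smul_isBigO _ _).trans (pow_isBigO_pow (not_lt.1 (Finset.mem_filter.1 hn).2))
  refine h.congr_left fun τ => ?_
  rw [key, eq_sub_iff_add_eq', Finset.sum_filter_add_sum_filter_not]
  simp only [wordSum, Finset.mul_sum, Finset.smul_sum]
  refine Finset.sum_congr rfl fun n _ => ?_
  rw [mul_smul_comm, smul_smul, pow_add, mul_comm]

theorem WordTree.mul_node (j : ℕ) (x : ℝ) (sub next : WordTree) (q : List ℕ → ℝ) (w : List ℕ) :
    (WordTree.node j x sub next).mul q w =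
      consMul j (fun w => x * q w + sub.mul q w) w + next.mul q w := by
  rcases w with _ | ⟨i, w⟩
  · have h (t : WordTree) : t.mul q [] = 0 := by cases t <;> rfl
    simp [h, consMul]
  · rfl

theorem WordTree.eval_isBigO (a : ℕ → 𝔸) (t : WordTree) :
    (fun τ => t.eval a τ) =O[𝓝 0] fun τ : ℝ => τ := by
  induction t with
  | nil => simpa [eval] using isBigO_zero _ _
  | node j x sub next ih₁ ih₂ =>
    refine IsBigO.add ?_ ih₂
    have h₁ : (fun τ => a (2 * j + 1) * (x • 1 + sub.eval a τ)) =O[𝓝 0] fun _ => (1 : ℝ) :=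
      (((tendsto_const_nhds (x := x • (1 : 𝔸))).add
        (ih₁.trans_tendsto tendsto_id)).const_mul (a (2 * j + 1))).isBigO_one ℝ
    have h₂ := (pow_isBigO_pow (show 1 ≤ 2 * j + 1 by omega)).smul h₁
    simpa using h₂

theorem WordTree.eval_mul_wordSum (N : ℕ) (a : ℕ → 𝔸) (t : WordTree) (q : List ℕ → ℝ) :
    EqMod N (fun τ => t.eval a τ * wordSum N a q τ) (wordSum N a (t.mul q)) := by
  induction t with
  | nil => exact EqMod.of_eq fun τ => by simp [eval, mul, wordSum_fun_zero]
  | node j x sub next ih₁ ih₂ =>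
    have h₁ := (EqMod.const_smul x (EqMod.refl N (wordSum N a q))).add ih₁
    have h₂ : EqMod N (fun τ : ℝ => τ ^ (2 * j + 1) • (a (2 * j + 1) *
        (x • wordSum N a q τ + sub.eval a τ * wordSum N a q τ)))
        (fun τ : ℝ => τ ^ (2 * j + 1) • (a (2 * j + 1) *
          wordSum N a (fun w => x * q w + sub.mul q w) τ)) := by
      have h₃ := (pow_isBigO_one (2 * j + 1)).smul
        (IsBigO.const_mul_left h₁ (a (2 * j + 1)))
      simp only [smul_eq_mul, one_mul] at h₃
      refine h₃.congr_left fun τ => ?_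
      simp only [wordSum_add, wordSum_const_mul, mul_sub, smul_sub]
    refine (EqMod.of_eq fun τ => ?_).trans
      (((h₂.trans (wordSum_consMul N a j _)).add ih₂).trans (EqMod.of_eq fun τ => ?_))
    · simp only [eval, add_mul, smul_mul_assoc, mul_assoc, one_mul]
    · rw [← wordSum_add, ← funext (WordTree.mul_node j x sub next q)]

/-- Horner recursion: the sum starting at `1 / k!` is `1 / k!` plus `t` times the sum starting at `1
/ (k + 1)!`, hence the induction over all `k`. -/
theorem WordTree.sum_eval_mul_wordSum (N : ℕ) (a : ℕ → 𝔸) (t : WordTree) (q : List ℕ → ℝ)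
    (k n : ℕ) :
    EqMod N (fun τ => (∑ i ∈ Finset.range n, (((k + i).factorial : ℝ)⁻¹) • t.eval a τ ^ i) *
      wordSum N a q τ) (wordSum N a (t.expMul q k n)) := by
  induction n generalizing k with
  | zero => exact EqMod.of_eq fun τ => by simp [expMul, wordSum_fun_zero]
  | succ n ih =>
    have ht : (fun τ => t.eval a τ) =O[𝓝 0] fun _ => (1 : ℝ) :=
      (t.eval_isBigO a).trans (by simpa only [pow_one] using pow_isBigO_one 1)
    have hs : (fun τ => (∑ i ∈ Finset.range n, (((k + 1 + i).factorial : ℝ)⁻¹) •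
        t.eval a τ ^ i) * wordSum N a q τ) =O[𝓝 0] fun _ => (1 : ℝ) :=
      (ih (k + 1)).isBigO_one (wordSum_isBigO_one _ _ _)
    have h₁ := ((EqMod.refl N _).mul (ih (k + 1)) ht hs).trans
      (t.eval_mul_wordSum N a (t.expMul q (k + 1) n))
    have h₂ := (EqMod.const_smul ((k.factorial : ℝ)⁻¹) (EqMod.refl N (wordSum N a q))).add h₁
    refine (EqMod.of_eq fun τ => ?_).trans (h₂.trans (EqMod.of_eq fun τ => ?_))
    · rw [Finset.sum_range_succ', ← mul_assoc, Finset.mul_sum, add_comm, add_mul]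
      simp only [pow_succ', mul_smul_comm, pow_zero, add_zero, smul_mul_assoc, one_mul]
      simp only [add_comm, add_left_comm]
    · rw [← wordSum_const_mul, ← wordSum_add]
      rfl

theorem wordSum_wordOne {N : ℕ} (hN : N ≠ 0) (a : ℕ → 𝔸) (τ : ℝ) : wordSum N a wordOne τ = 1 := by
  obtain ⟨M, rfl⟩ := Nat.exists_eq_succ_of_ne_zero hN
  have h (n : ℕ) : wordCoeff a wordOne (n + 1) = 0 := by
    rw [wordCoeff_succ]
    exact Finset.sum_eq_zero fun j _ => by simp [wordOne, wordCoeff_fun_zero]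
  simp [wordSum, Finset.sum_range_succ', h, wordCoeff_zero, wordOne]

variable [CompleteSpace 𝔸]

theorem WordTree.exp_eval_mul_wordSum (N : ℕ) (a : ℕ → 𝔸) (t : WordTree) (q : List ℕ → ℝ) :
    EqMod N (fun τ => NormedSpace.exp (t.eval a τ) * wordSum N a q τ)
      (wordSum N a (t.expMul q 0 N)) := by
  have h := (exp_eqMod_sum (N := N) (t.eval_isBigO a)).mul (EqMod.refl N (wordSum N a q)) ?_
    (wordSum_isBigO_one _ _ _)
  · refine h.trans ?_
    simpa using t.sum_eval_mul_wordSum N a q 0 N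
  · exact (exp_eqMod_sum (t.eval_isBigO a)).symm.isBigO_one
      ((tendsto_exp_one ((t.eval_isBigO a).trans_tendsto tendsto_id)).isBigO_one ℝ)

end Words

end Yoshida

namespace Yoshida

open Idx

/-! ### The tries of both exponents. -/

section Step

/-- The trie of the noncommutative polynomial `∑ j, v ^ (2 j + 1) xⱼ`, `j < 5`. -/
def lettersTree (v : ℝ) : WordTree :=
  .node 0 v .nil <| .node 1 (v ^ 3) .nil <| .node 2 (v ^ 5) .nil <| .node 3 (v ^ 7) .nil <|
  .node 4 (v ^ 9) .nil .nil

/-- The trie of `expansion`. -/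
def expansionTree (c : Idx → ℝ) : WordTree :=
  .node 0 (c A1) (.node 0 0 (.node 0 0 (.node 0 0 (.node 0 0 (.node 0 0 (.node 1 (c E9) .nil .nil) <|
            .node 1 0 (.node 0 (-6 * c E9) .nil .nil) .nil) <|
          .node 1 (c D7) (.node 0 0 (.node 0 (15 * c E9) .nil .nil) .nil) <|
          .node 2 (c D9₁) .nil .nil) <|
        .node 1 0 (.node 0 (-4 * c D7) (.node 0 0 (.node 0 (-20 * c E9) .nil .nil) .nil) <|
          .node 1 (-c D9₂ - c D9₃) .nil .nil) <|
        .node 2 0 (.node 0 (-4 * c D9₁) .nil .nil) .nil) <|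
      .node 1 (c B5) (.node 0 0 (.node 0 (6 * c D7) (.node 0 0 (.node 0 (15 * c E9) .nil .nil) .nil) <|
          .node 1 (3 * c D9₂ + 2 * c D9₃) .nil .nil) <|
        .node 1 0 (.node 0 (c D9₃) .nil .nil) .nil) <|
      .node 2 (c B7) (.node 0 0 (.node 0 (6 * c D9₁) .nil .nil) .nil) <|
      .node 3 (c B9) .nil .nil) <|
    .node 1 0 (.node 0 (-2 * c B5) (.node 0 0 (.node 0 (-4 * c D7) (.node 0 0 (.node 0 (-6 * c E9) .nil .nil) .nil) <|
          .node 1 (-3 * c D9₂) .nil .nil) <|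
        .node 1 0 (.node 0 (-4 * c D9₃) .nil .nil) .nil) <|
      .node 1 (c C7) (.node 0 0 (.node 0 (c D9₃) .nil .nil) .nil) <|
      .node 2 (c C9₁ - c C9₃) .nil .nil) <|
    .node 2 0 (.node 0 (-2 * c B7) (.node 0 0 (.node 0 (-4 * c D9₁) .nil .nil) .nil) <|
      .node 1 (-c C9₁ - c C9₂) .nil .nil) <|
    .node 3 0 (.node 0 (-2 * c B9) .nil .nil) .nil) <|
  .node 1 (c A3) (.node 0 0 (.node 0 (c B5) (.node 0 0 (.node 0 (c D7) (.node 0 0 (.node 0 (c E9) .nil .nil) .nil) <|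
          .node 1 (2 * c D9₂) .nil .nil) <|
        .node 1 0 (.node 0 (-3 * c D9₂) .nil .nil) .nil) <|
      .node 1 (-2 * c C7) (.node 0 0 (.node 0 (3 * c D9₂ + 2 * c D9₃) .nil .nil) .nil) <|
      .node 2 (c C9₂ + c C9₃) .nil .nil) <|
    .node 1 0 (.node 0 (c C7) (.node 0 0 (.node 0 (-c D9₂ - c D9₃) .nil .nil) .nil) .nil) <|
    .node 2 0 (.node 0 (-c C9₁ - c C9₂) .nil .nil) .nil) <|
  .node 2 (c A5) (.node 0 0 (.node 0 (c B7) (.node 0 0 (.node 0 (c D9₁) .nil .nil) .nil) <|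
      .node 1 (c C9₂ + c C9₃) .nil .nil) <|
    .node 1 0 (.node 0 (c C9₁ - c C9₃) .nil .nil) .nil) <|
  .node 3 (c A7) (.node 0 0 (.node 0 (c B9) .nil .nil) .nil) <|
  .node 4 (c A9) .nil .nil

variable {𝔸 : Type*} [NormedRing 𝔸] [NormedAlgebra ℝ 𝔸]

-- Expanding the nested commutators into words gives the integers of the trie; for instance `1, -6,
-- 15, -20, 15, -6, 1` are the signed binomials of the sixfold commutator with `a 1`.
set_option maxHeartbeats 4000000 in
theorem eval_expansionTree (a : ℕ → 𝔸) (c : Idx → ℝ) (τ : ℝ) :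
    (expansionTree c).eval a τ = expansion a c τ := by
  simp only [expansionTree, WordTree.eval, expansion, nest, Ring.lie_def, mul_add, mul_sub, sub_mul,
    mul_smul_comm, mul_one, mul_assoc, smul_add, smul_sub, smul_smul,
    add_zero, zero_smul, zero_add, mul_zero]
  module

end Step
end Yoshida

namespace Yoshida
open Idx
-- Word-by-word verification of the recursion in odd weights.
section Step

/-- The coefficients of `exp L * exp V` and of `exp (-V) * exp L'` agree at the word `w`, where `V`,
`L` and `L'` are given by `lettersTree v`, by `expansionTree c` and by the coefficients after a
step. -/
def StepAgrees (c : Idx → ℝ) (v : ℝ) (w : List ℕ) : Prop :=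
  (expansionTree c).expMul ((lettersTree v).expMul wordOne 0 11) 0 11 w =
    (lettersTree (-v)).expMul
      ((expansionTree (step (algebraMap ℚ ℝ) v c)).expMul wordOne 0 11) 0 11 w

-- Moving one `exp V` across leaves two exponentials on each side, which keeps the coefficients
-- short. Once the words are enumerated and the recursions unfolded, each case is a polynomial
-- identity in `v` and the `c i`.
set_option maxHeartbeats 20000000 in
theorem stepAgrees_of_le_seven (c : Idx → ℝ) (v : ℝ) :
    ∀ n ∈ [1, 3, 5, 7], ∀ w ∈ words n, StepAgrees c v w := by
  simp [words, List.range_succ]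
  simp [StepAgrees, lettersTree, expansionTree, WordTree.mul, WordTree.expMul, wordOne, step,
    Nat.factorial]
  constructorm* _ ∧ _
  all_goals ring

set_option maxHeartbeats 20000000 in
theorem stepAgrees_nine (c : Idx → ℝ) (v : ℝ) : ∀ w ∈ words 9, StepAgrees c v w := by
  simp [words, List.range_succ]
  simp [StepAgrees, lettersTree, expansionTree, WordTree.mul, WordTree.expMul, wordOne, step,
    Nat.factorial]
  constructorm* _ ∧ _
  all_goals ring

theorem stepAgrees_of_odd (c : Idx → ℝ) (v : ℝ) {n : ℕ} (hn : n < 11) (ho : Odd n) :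
    ∀ w ∈ words n, StepAgrees c v w := by
  by_cases h : n = 9
  · exact h ▸ stepAgrees_nine c v
  · refine stepAgrees_of_le_seven c v n ?_
    obtain ⟨k, rfl⟩ := ho
    simp only [List.mem_cons, List.not_mem_nil, or_false]
    omega

end Step

end Yoshida

namespace Yoshida

open Idx

/-! ### Even-order discrepancies are excluded by time symmetry. -/

section Parity

theorem mul_mul_mul_eq_one {M : Type*} [Monoid M] {a b c a' b' c' : M} (ha : a * a' = 1)
    (hb : b * b' = 1) (hc : c * c' = 1) : a * b * c * (c' * b' * a') = 1 := by
  rw [mul_assoc (a * b), ← mul_assoc c, ← mul_assoc c, hc, one_mul, mul_assoc a, ← mul_assoc b, hb,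
    one_mul, ha]

variable {𝔸 : Type*} [NormedRing 𝔸]

theorem EqMod.mono {M N : ℕ} {f g : ℝ → 𝔸} (h : EqMod N f g) (hMN : M ≤ N) : EqMod M f g :=
  IsBigO.trans h (pow_isBigO_pow hMN)

theorem one_isBigO_one : (fun _ : ℝ => (1 : 𝔸)) =O[𝓝 0] fun _ => (1 : ℝ) :=
  isBigO_const_const _ one_ne_zero _

theorem EqMod.isBigO_one_of_one {f : ℝ → 𝔸} (h : EqMod 1 f fun _ => 1) :
    f =O[𝓝 0] fun _ => (1 : ℝ) :=
  h.isBigO_one one_isBigO_one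

variable [NormedAlgebra ℝ 𝔸]

theorem EqMod.pow_smul_mul {n : ℕ} {f : ℝ → 𝔸} (h : EqMod 1 f fun _ => 1) (D : 𝔸) :
    EqMod (n + 1) (fun τ => (τ ^ n • D) * f τ) fun τ => τ ^ n • D :=
  ((pow_smul_isBigO n D).mul h).congr (fun τ => by rw [mul_sub, mul_one])
    fun τ => by rw [pow_one, pow_succ]

theorem EqMod.mul_pow_smul {n : ℕ} {f : ℝ → 𝔸} (h : EqMod 1 f fun _ => 1) (D : 𝔸) :
    EqMod (n + 1) (fun τ => f τ * (τ ^ n • D)) fun τ => τ ^ n • D :=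
  (IsBigO.mul h (pow_smul_isBigO n D)).congr (fun τ => by rw [sub_mul, one_mul])
    fun τ => by rw [pow_one, pow_succ']

/-- Two functions with `F τ * F (-τ) = 1` cannot differ at leading order by an even power. -/
theorem eq_zero_of_even_of_eqMod {n : ℕ} (hn : Even n) {F E : ℝ → 𝔸} {D : 𝔸}
    (hF : ∀ τ, F τ * F (-τ) = 1) (hE : ∀ τ, E τ * E (-τ) = 1) (hF₁ : EqMod 1 F fun _ => 1)
    (hE₁ : EqMod 1 E fun _ => 1) (h : EqMod (n + 1) F fun τ => E τ + τ ^ n • D) : D = 0 := by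
  have hFn : EqMod 1 (fun τ => F (-τ)) fun _ => 1 := by simpa using hF₁.comp_mul (-1)
  have hD : (fun τ : ℝ => τ ^ n • D) =O[𝓝 0] fun _ => (1 : ℝ) :=
    (pow_smul_isBigO n D).trans (pow_isBigO_one n)
  -- Multiply the hypothesis by `F(-τ)` on the right; since `F(-τ) → 1`, the term `τ^n • D` is
  -- unchanged at this order.
  have h₁ : EqMod (n + 1) (fun _ => 1) fun τ => E τ * F (-τ) + τ ^ n • D := by
    have := (h.mul (EqMod.refl _ fun τ => F (-τ)) (hE₁.isBigO_one_of_one.add hD)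
      hFn.isBigO_one_of_one).trans (EqMod.of_eq fun τ => add_mul _ _ _)
    simp only [hF] at this
    exact this.trans ((EqMod.refl _ _).add (hFn.pow_smul_mul D))
  -- The hypothesis at `-τ`, where evenness of `n` keeps the sign of `D`, multiplied by `E(τ)` on
  -- the left. Together with `h₁` this gives `2 τ^n D = O(τ^(n+1))`.
  have h₂ : EqMod (n + 1) (fun τ => E τ * F (-τ)) fun τ => 1 + τ ^ n • D := by
    have h' : EqMod (n + 1) (fun τ => F (-τ)) fun τ => E (-τ) + τ ^ n • D := by
      simpa [hn.neg_pow] using h.comp_mul (-1)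
    have := ((EqMod.refl _ E).mul h' hE₁.isBigO_one_of_one hFn.isBigO_one_of_one).trans
      (EqMod.of_eq fun τ => mul_add _ _ _)
    simp only [hE] at this
    exact this.trans ((EqMod.refl _ _).add (hE₁.mul_pow_smul D))
  have h₃ := (h₁.trans (h₂.add (EqMod.refl _ fun τ : ℝ => τ ^ n • D))).symm
  have h₄ : (2 : ℝ) • D = 0 := eq_zero_of_pow_smul_isBigO (n := n) (h₃.congr_left fun τ => by
    beta_reduce
    rw [two_smul, smul_add]
    abel)
  exact (smul_eq_zero_iff_right two_ne_zero).1 h₄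

end Parity

/-! ### The induction step for logarithms and the induction on `m`. -/

section Main

variable {𝔸 : Type*} [NormedRing 𝔸] [NormedAlgebra ℝ 𝔸]

theorem expansion_neg (a : ℕ → 𝔸) (c : Idx → ℝ) (τ : ℝ) :
    expansion a c (-τ) = -expansion a c τ := by
  simp only [expansion]
  module

theorem eval_lettersTree (a : ℕ → 𝔸) (v τ : ℝ) :
    (lettersTree v).eval a τ = expansion a (init v) τ := by
  simp only [lettersTree, WordTree.eval, expansion, init, mul_smul_comm, mul_one,
    add_zero, zero_smul, mul_zero]
  module

theorem eval_lettersTree_neg (a : ℕ → 𝔸) (v τ : ℝ) :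
    (lettersTree (-v)).eval a τ = -expansion a (init v) τ := by
  rw [eval_lettersTree]
  simp only [expansion, init]
  module

theorem expansion_isBigO (a : ℕ → 𝔸) (c : Idx → ℝ) :
    expansion a c =O[𝓝 0] fun τ : ℝ => τ := by
  simpa only [eval_expansionTree] using (expansionTree c).eval_isBigO a

theorem ansatz_succ {J : ℕ} (X : Fin J → 𝔸) (w : ℕ → ℝ) (m : ℕ) (τ : ℝ) :
    ansatz X w (m + 1) τ = S₂ X (w (m + 1) * τ) * ansatz X w m τ * S₂ X (w (m + 1) * τ) := by
  simp only [ansatz]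
  rw [List.range_succ_eq_map, ← List.range_succ_eq_map (n := m)]
  -- The new factor is the first one of the left product but the last one of the right product, so
  -- the two ranges are split at opposite ends.
  nth_rewrite 1 [List.range_succ_eq_map]
  rw [List.range_succ]
  simp [mul_assoc, Function.comp_def]

theorem expansion_of_tenthOrderConditions (a : ℕ → 𝔸) {c : Idx → ℝ}
    (hc : TenthOrderConditions c) (h : c C9₂ = c C9₁ + c C9₃) (τ : ℝ) :
    expansion a c τ = τ • a 1 := by
  obtain ⟨h₁, h₂, h₃, h₄, h₅, h₆, h₇, h₈, h₉, h₁₀, h₁₁, h₁₂, h₁₃, h₁₄, h₁₅, h₁₆⟩ := hc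
  rw [h₁₁, h₁₂, add_zero] at h
  simp [expansion, *]

variable [CompleteSpace 𝔸]

theorem exp_mul_exp_neg (x : 𝔸) : NormedSpace.exp x * NormedSpace.exp (-x) = 1 := by
  let _ : NormedAlgebra ℚ 𝔸 := NormedAlgebra.restrictScalars ℚ ℝ 𝔸
  rw [← NormedSpace.exp_add_of_commute (Commute.refl x).neg_right, add_neg_cancel,
    NormedSpace.exp_zero]

theorem exp_eqMod_one {f : ℝ → 𝔸} (hf : f =O[𝓝 0] fun τ : ℝ => τ) :
    EqMod 1 (fun τ => NormedSpace.exp (f τ)) fun _ => 1 := by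
  simpa using exp_eqMod_sum (N := 1) hf

/-- The passage from `S^(m)` to `S^(m+1)` on the level of logarithms. -/
theorem exp_expansion_step (a : ℕ → 𝔸) (c : Idx → ℝ) (v : ℝ) :
    EqMod 11 (fun τ => NormedSpace.exp (expansion a (init v) τ) *
        NormedSpace.exp (expansion a c τ) * NormedSpace.exp (expansion a (init v) τ))
      fun τ => NormedSpace.exp (expansion a (step (algebraMap ℚ ℝ) v c) τ) := by
  set c' := step (algebraMap ℚ ℝ) v c
  set V : ℝ → 𝔸 := expansion a (init v) with hV
  set L : ℝ → 𝔸 := expansion a c with hL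
  set L' : ℝ → 𝔸 := expansion a c' with hL'
  have bV := exp_eqMod_one (expansion_isBigO a (init v))
  have bL := exp_eqMod_one (expansion_isBigO a c)
  have bL' := exp_eqMod_one (expansion_isBigO a c')
  have bVn : EqMod 1 (fun τ => NormedSpace.exp (-V τ)) fun _ => 1 :=
    exp_eqMod_one (expansion_isBigO a (init v)).neg_left
  set g := (expansionTree c).expMul ((lettersTree v).expMul wordOne 0 11) 0 11 with hg
  set k := (lettersTree (-v)).expMul ((expansionTree c').expMul wordOne 0 11) 0 11 with hk
  have h_one (t : WordTree) : EqMod 11 (fun τ => NormedSpace.exp (t.eval a τ))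
      (wordSum 11 a (t.expMul wordOne 0 11)) := by
    simpa [wordSum_wordOne] using t.exp_eval_mul_wordSum 11 a wordOne
  have hG : EqMod 11 (fun τ => NormedSpace.exp (L τ) * NormedSpace.exp (V τ))
      (wordSum 11 a g) := by
    have h := (expansionTree c).exp_eval_mul_wordSum 11 a ((lettersTree v).expMul wordOne 0 11)
    have h' := h_one (lettersTree v)
    simp only [eval_expansionTree, eval_lettersTree] at h h'
    exact ((EqMod.refl _ _).mul h' bL.isBigO_one_of_one bV.isBigO_one_of_one).trans h
  have hK : EqMod 11 (fun τ => NormedSpace.exp (-V τ) * NormedSpace.exp (L' τ))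
      (wordSum 11 a k) := by
    have h := (lettersTree (-v)).exp_eval_mul_wordSum 11 a
      ((expansionTree c').expMul wordOne 0 11)
    have h' := h_one (expansionTree c')
    simp only [eval_expansionTree, eval_lettersTree_neg] at h h'
    exact ((EqMod.refl _ _).mul h' bVn.isBigO_one_of_one bL'.isBigO_one_of_one).trans h
  set d : ℕ → 𝔸 := fun n => wordCoeff a g n - wordCoeff a k n with hd
  -- A discrepancy `D` between `exp L · exp V` and `exp(-V) · exp L'` becomes `exp V · D` in the
  -- symmetric form, where the parity argument applies.
  have hFE (N : ℕ) (hN : N ≤ 11) (D : ℝ → 𝔸) (hD : D =O[𝓝 0] fun _ => (1 : ℝ))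
      (hsum : EqMod N (fun τ => ∑ n ∈ Finset.range 11, τ ^ n • d n) D) :
      EqMod N (fun τ => NormedSpace.exp (V τ) * NormedSpace.exp (L τ) * NormedSpace.exp (V τ))
        fun τ => NormedSpace.exp (L' τ) + NormedSpace.exp (V τ) * D τ := by
    have h₁ : EqMod N (fun τ => NormedSpace.exp (L τ) * NormedSpace.exp (V τ))
        fun τ => NormedSpace.exp (-V τ) * NormedSpace.exp (L' τ) + D τ := by
      refine (hG.mono hN).trans (EqMod.trans (EqMod.of_eq fun τ => ?_)
        ((hK.mono hN).symm.add hsum))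
      simp only [wordSum, hd, smul_sub, Finset.sum_sub_distrib, add_sub_cancel]
    have bG : (fun τ => NormedSpace.exp (L τ) * NormedSpace.exp (V τ)) =O[𝓝 0]
        fun _ => (1 : ℝ) := hG.isBigO_one (wordSum_isBigO_one _ _ _)
    have h₂ := (EqMod.refl N fun τ => NormedSpace.exp (V τ)).mul h₁ bV.isBigO_one_of_one bG
    refine (EqMod.of_eq fun τ => mul_assoc _ _ _).trans (h₂.trans (EqMod.of_eq fun τ => ?_))
    rw [mul_add, ← mul_assoc, exp_mul_exp_neg, one_mul]
  have hd₀ : ∀ n < 11, d n = 0 := by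
    intro n
    induction n using Nat.strong_induction_on with
    | _ n ih =>
      intro hn
      rcases Nat.even_or_odd n with he | ho
      · have hsum : EqMod (n + 1) (fun τ => ∑ n ∈ Finset.range 11, τ ^ n • d n)
            fun τ => τ ^ n • d n := by
          refine IsBigO.congr_left (f₁ := fun τ => ∑ k ∈ (Finset.range 11).erase n, τ ^ k • d k)
            (IsBigO.fun_sum fun k hk => ?_) fun τ => ?_
          · obtain ⟨hkn, hk⟩ := Finset.mem_erase.1 hk
            rcases lt_or_gt_of_ne hkn with hlt | hgt
            · simpa [ih k hlt (Finset.mem_range.1 hk)] using isBigO_zero _ _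
            · exact (pow_smul_isBigO k (d k)).trans (pow_isBigO_pow hgt)
          · beta_reduce
            rw [← Finset.add_sum_erase _ _ (Finset.mem_range.2 hn), add_sub_cancel_left]
        -- With the lower discrepancies gone, `exp V · τ^n d_n` equals `τ^n d_n` modulo `τ^(n+1)`,
        -- so `d_n` is the leading difference.
        have h₁ := (hFE (n + 1) hn _ ((pow_smul_isBigO n (d n)).trans (pow_isBigO_one n))
          hsum).trans ((EqMod.refl _ _).add (bV.mul_pow_smul (d n)))
        refine eq_zero_of_even_of_eqMod he (fun τ => ?_) (fun τ => ?_) ?_ bL' h₁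
        · simp only [hV, hL, expansion_neg]
          exact mul_mul_mul_eq_one (exp_mul_exp_neg _) (exp_mul_exp_neg _) (exp_mul_exp_neg _)
        · simp only [expansion_neg, exp_mul_exp_neg]
        · simpa using (bV.mul bL one_isBigO_one bL.isBigO_one_of_one).mul bV
            (by simpa using one_isBigO_one) bV.isBigO_one_of_one
      · exact sub_eq_zero.2 (wordCoeff_congr a n (stepAgrees_of_odd c v hn ho))
  have h := hFE 11 le_rfl (fun _ => 0) (isBigO_zero _ _) (EqMod.of_eq fun τ =>
    Finset.sum_eq_zero fun n hn => by rw [hd₀ n (Finset.mem_range.1 hn), smul_zero])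
  simpa using h

theorem S₂_mul_eqMod {J : ℕ} (X : Fin J → 𝔸) (v : ℝ) :
    EqMod 11 (fun τ => S₂ X (v * τ))
      fun τ => NormedSpace.exp (expansion (α X) (init v) τ) := by
  refine ((S₂_eqMod_exp X (N := 11) (by norm_num)).comp_mul v).trans (EqMod.of_eq fun τ => ?_)
  congr 1
  have h (k : ℕ) : α X (2 * k) = 0 := α_even X (even_two_mul k)
  have h₀ := h 0
  have h₂ := h 1
  have h₄ := h 2
  have h₆ := h 3
  have h₈ := h 4
  have h₁₀ := h 5
  norm_num at h₀ h₂ h₄ h₆ h₈ h₁₀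
  simp only [Finset.sum_range_succ, Finset.sum_range_zero, h₀, h₂, h₄, h₆, h₈, h₁₀, expansion, init]
  module

theorem coeffVal_zero (w : ℕ → ℝ) : coeffVal w 0 = init (w 0) := by
  funext i
  cases i <;> simp [coeffVal, coeffPoly, init]

theorem coeffVal_succ (w : ℕ → ℝ) (m : ℕ) :
    coeffVal w (m + 1) = step (algebraMap ℚ ℝ) (w (m + 1)) (coeffVal w m) := by
  funext i
  cases i <;> simp [coeffVal, coeffPoly, step]

theorem ansatz_eqMod {J : ℕ} (X : Fin J → 𝔸) (w : ℕ → ℝ) (m : ℕ) :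
    EqMod 11 (ansatz X w m) fun τ => NormedSpace.exp (expansion (α X) (coeffVal w m) τ) := by
  induction m with
  | zero =>
    rw [coeffVal_zero]
    exact (EqMod.of_eq fun τ => by simp [ansatz]).trans (S₂_mul_eqMod X (w 0))
  | succ m ih =>
    rw [coeffVal_succ]
    have hS := S₂_mul_eqMod X (w (m + 1))
    have b (c : Idx → ℝ) : (fun τ => NormedSpace.exp (expansion (α X) c τ)) =O[𝓝 0]
        fun _ => (1 : ℝ) :=
      (exp_eqMod_one (expansion_isBigO (α X) c)).isBigO_one_of_one
    have h := (hS.mul ih (b _) (ih.isBigO_one (b _))).mul hS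
      (by simpa using (b _).mul (b _)) (hS.isBigO_one (b _))
    exact (EqMod.of_eq fun τ => ansatz_succ X w m τ).trans
      (h.trans (exp_expansion_step (α X) (coeffVal w m) (w (m + 1))))

theorem coeffPoly_mem_adjoin (m : ℕ) (i : Idx) :
    coeffPoly m i ∈ MvPolynomial.supported ℚ (Finset.range (m + 1) : Set ℕ) := by
  induction m generalizing i with
  | zero =>
    have hX : (MvPolynomial.X 0 : MvPolynomial ℕ ℚ) ∈
        MvPolynomial.supported ℚ (Finset.range 1 : Set ℕ) := by simp
    cases i <;> simp only [coeffPoly, init] <;>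
      first
        | exact zero_mem _
        | exact hX
        | exact pow_mem hX _
  | succ m ih =>
    have hX : (MvPolynomial.X (m + 1) : MvPolynomial ℕ ℚ) ∈
        MvPolynomial.supported ℚ (Finset.range (m + 1 + 1) : Set ℕ) := by simp
    have hc (i : Idx) : coeffPoly m i ∈
        MvPolynomial.supported ℚ (Finset.range (m + 1 + 1) : Set ℕ) :=
      MvPolynomial.supported_mono (by simp [Set.subset_def]; omega) (ih i)
    have hC (q : ℚ) : MvPolynomial.C q ∈
        MvPolynomial.supported ℚ (Finset.range (m + 1 + 1) : Set ℕ) :=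
      Subalgebra.algebraMap_mem _ q
    have h2 : (2 : MvPolynomial ℕ ℚ) ∈
        MvPolynomial.supported ℚ (Finset.range (m + 1 + 1) : Set ℕ) := by
      simpa only [map_ofNat] using hC 2
    -- From here only closure of a subalgebra under the ring operations matters.
    generalize MvPolynomial.supported ℚ (Finset.range (m + 1 + 1) : Set ℕ) = A at hX hc hC h2
    cases i <;> simp only [coeffPoly, step] <;>
      repeat' first
        | with_reducible exact hX
        | with_reducible exact hc _
        | with_reducible exact hC _
        | with_reducible exact h2
        | with_reducible apply add_mem
        | with_reducible apply sub_mem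
        | with_reducible apply mul_mem
        | with_reducible apply pow_mem

/-- The increments satisfy the same linear relation. This is why `C9₂` need not appear among the
order conditions. -/
theorem coeffPoly_C₂ (m : ℕ) : coeffPoly m C9₂ = coeffPoly m C9₁ + coeffPoly m C9₃ := by
  induction m with
  | zero => simp [coeffPoly, init]
  | succ m ih =>
    simp only [coeffPoly, step, ih]
    ring

end Main

end Yoshida

theorem mainTheorem1 {𝔸 : Type*} [NormedRing 𝔸] [NormedAlgebra ℝ 𝔸] [CompleteSpace 𝔸] (m : ℕ) :
    (∀ i : Yoshida.Idx, (Yoshida.coeffPoly m i).vars ⊆ Finset.range (m + 1)) ∧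
    Yoshida.coeffPoly m .C9₂ = Yoshida.coeffPoly m .C9₁ + Yoshida.coeffPoly m .C9₃ ∧
    ∀ (J : ℕ) (X : Fin J → 𝔸) (w : ℕ → ℝ),
      (∃ r : ℝ → 𝔸, r =O[𝓝 0] (fun τ : ℝ => τ ^ 11) ∧
        ∀ᶠ τ in 𝓝 (0 : ℝ), Yoshida.ansatz X w m τ =
          NormedSpace.exp
            (Yoshida.expansion (Yoshida.α X) (Yoshida.coeffVal w m) τ + r τ)) ∧
      (Yoshida.TenthOrderConditions (Yoshida.coeffVal w m) →
        (fun τ : ℝ => Yoshida.ansatz X w m τ - NormedSpace.exp (τ • ∑ j, X j))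
          =O[𝓝 0] (fun τ : ℝ => τ ^ 11)) := by
  refine ⟨fun i => ?_, Yoshida.coeffPoly_C₂ m, fun J X w => ⟨?_, fun hc => ?_⟩⟩
  · exact_mod_cast MvPolynomial.mem_supported.1 (Yoshida.coeffPoly_mem_adjoin m i)
  · exact Yoshida.exists_eq_exp_add (by norm_num)
      ((Yoshida.expansion_isBigO _ _).trans_tendsto tendsto_id) (Yoshida.ansatz_eqMod X w m)
  · refine (Yoshida.ansatz_eqMod X w m).congr_left fun τ => ?_
    beta_reduce
    rw [Yoshida.expansion_of_tenthOrderConditions _ hc, Yoshida.α_one]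
    simp [Yoshida.coeffVal, Yoshida.coeffPoly_C₂ m]
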